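/- Let $q\in\mathbb C$ with $0<|q|<1$, fix a square root $q^{1/2}$ of $q$ and put $q^{m/2}=(q^{1/2})^m$ for $m\in\mathbb Z$. Write $(a;q)_\infty=\prod_{n\ge 0}(1-aq^n)$ and $(a_1,\dots,a_r;q)_\infty=(a_1;q)_\infty\cdots(a_r;q)_\infty$. Let $a_1,\dots,a_4\in\mathbb C\setminus\{0\}$ satisfy $|a_1a_2a_3a_4|>|q|$, and let $b_1,\dots,b_4\in\mathbb C$ be generic in the sense that $b_jb_kq^n\neq 1$ for all $j,k\in\{1,\dots,4\}$ (including $j=k$) and all integers $n\ge 0$. Then for each $m\in\mathbb Z$ there is a positively oriented contour $C_m$ separating the poles $q^{k-m/2}b_j$ ($1\le j\le 4$, $k\ge 0$), which converge to $0$, from the poles $q^{-k-m/2}/b_j$ ($1\le j\le 4$, $b_j\ne 0$, $k\ge 0$), which go to infinity; that is, a closed piecewise $C^1$ curve that avoids $0$ and all these points, has winding number $1$ around $0$ and around each point of the first kind, and winding number $0$ around each point of the second kind. For any choice of such contours, $$\sum_{m=-\infty}^{\infty}\oint_{C_m}\prod_{j=1}^4\frac{(q^{1+m/2}/a_jz,\;q^{1-m/2}z/a_j;q)_\infty}{(q^{m/2}b_jz,\;q^{-m/2}b_j/z;q)_\infty}\;\frac{(1-q^mz^2)(1-q^mz^{-2})}{q^mz^{4m}}\;\frac{dz}{2\pi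 i z}=\frac{2\,(b_1b_2b_3b_4;q)_\infty}{(q/a_1a_2a_3a_4;q)_\infty}\prod_{1\le j<k\le 4}\frac{(q/a_ja_k;q)_\infty}{(b_jb_k;q)_\infty},$$ where the series on the left converges absolutely. -/

import Mathlib

/-- The infinite `q`-shifted factorial `(a; q)_∞ = ∏_{n ≥ 0} (1 - a q ^ n)`. -/
noncomputable def qPochInf (a q : ℂ) : ℂ := ∏' n : ℕ, (1 - a * q ^ n)

/-- The contour integral `∫_γ f(z) dz` of a complex function along a closed curve, i.e. the
curve integral of the one-form `f(z) dz`. -/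
noncomputable def contourIntegral (f : ℂ → ℂ) {p : ℂ} (γ : Path p p) : ℂ :=
  curveIntegral (fun z => f z • ContinuousLinearMap.id ℂ ℂ) γ

/-- The winding number of a closed curve around a point `w` off the curve. -/
noncomputable def windingNumber {p : ℂ} (γ : Path p p) (w : ℂ) : ℂ :=
  (2 * (Real.pi : ℂ) * Complex.I)⁻¹ * contourIntegral (fun z => (z - w)⁻¹) γ

/-- A curve is piecewise `C¹` if, for some finite set `P` of break points, it is `C¹`
(with one-sided derivatives at the end points) on every closed parameter interval with no
break point in its interior. -/
def IsPiecewiseC1 {p : ℂ} (γ : Path p p) : Prop :=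
  ∃ P : Finset ℝ, ∀ u v : ℝ, 0 ≤ u → u < v → v ≤ 1 → (∀ t ∈ P, t ∉ Set.Ioo u v) →
    ContDiffOn ℝ 1 γ.extend (Set.Icc u v)

/-- `γ` is a positively oriented contour separating the set `S` (inside) from the set `T`
(outside): a closed piecewise `C¹` curve that avoids both sets, winds once in the positive
sense around every point of `S`, and does not wind around any point of `T`. -/
structure IsSeparatingContour {p : ℂ} (γ : Path p p) (S T : Set ℂ) : Prop where
  piecewiseC1 : IsPiecewiseC1 γ
  avoids_inside : ∀ t, γ t ∉ S
  avoids_outside : ∀ t, γ t ∉ T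
  winding_inside : ∀ w ∈ S, windingNumber γ w = 1
  winding_outside : ∀ w ∈ T, windingNumber γ w = 0

/-- The integrand, without the measure `dz / (2 π i z)`. Here `s` is a square root of `q`, so that
`q ^ (m / 2)` is `s ^ m`. -/
noncomputable def wpIntegrand (q s : ℂ) (a b : Fin 4 → ℂ) (m : ℤ) (z : ℂ) : ℂ :=
  (∏ j : Fin 4,
    (qPochInf (q * s ^ m / (a j * z)) q * qPochInf (q * s ^ (-m) * z / a j) q) /
      (qPochInf (s ^ m * b j * z) q * qPochInf (s ^ (-m) * b j / z) q)) *
  ((1 - q ^ m * z ^ 2) * (1 - q ^ m * z ^ (-2 : ℤ)) / (q ^ m * z ^ (4 * m)))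

/-- The geometric sequences of poles `q ^ (k - m / 2) b_j`, `k ≥ 0`, which converge to `0`,
together with their limit `0`. -/
def polesToZero (q s : ℂ) (b : Fin 4 → ℂ) (m : ℤ) : Set ℂ :=
  {z | z = 0 ∨ ∃ (j : Fin 4) (k : ℕ), z = s ^ (-m) * b j * q ^ k}

/-- The geometric sequences of poles `q ^ (- k - m / 2) / b_j`, `k ≥ 0`, which go to infinity
(there are none for those `j` with `b_j = 0`). -/
def polesToInfinity (q s : ℂ) (b : Fin 4 → ℂ) (m : ℤ) : Set ℂ :=
  {z | ∃ (j : Fin 4) (k : ℕ), s ^ m * b j * z * q ^ k = 1}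

/-!
Put `q = s ^ 2`. In the variable `s ^ m * z` the pole sets of the `m`-th integral no longer depend
on `m`, and the integrands differ only through a factor `poisedTerm`. An integral of a function
whose poles are those of the products `(b_j z, b_j / z; q)_∞` depends on the contour only through
winding numbers: Cauchy's formula in an annulus reduces this to rational functions, and partial
fractions to the definition of the winding number. So all contours may be replaced by a single
one, and the sum may be taken under the integral sign. There it is Bailey's very-well-poised
bilateral series `₆ψ₆`, equal to an infinite product times a theta function in `z`, and what
remains is an integral of Askey–Wilson type. The series and the integral are both evaluated by a
contiguous relation that multiplies one parameter by `q`. The error term in this relation is a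
difference, which telescopes in the sum, respectively is integrated to zero by moving the contour
by a factor `q`. Iterating it drives all parameters to `0`, where the evaluation is immediate.
-/

section QPochhammer

open Filter Topology

variable {q : ℂ}

theorem summable_norm_mul_pow (hq : ‖q‖ < 1) (a : ℂ) : Summable fun n : ℕ => ‖-(a * q ^ n)‖ := by
  simpa using (summable_geometric_of_lt_one (norm_nonneg q) hq).mul_left ‖a‖

theorem multipliable_qPochInf (hq : ‖q‖ < 1) (a : ℂ) : Multipliable fun n : ℕ => 1 - a * q ^ n := by
  simpa [sub_eq_add_neg] using multipliable_one_add_of_summable (summable_norm_mul_pow hq a)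

theorem tendsto_prod_qPochInf (hq : ‖q‖ < 1) (a : ℂ) :
    Tendsto (fun n : ℕ => ∏ i ∈ Finset.range n, (1 - a * q ^ i)) atTop (𝓝 (qPochInf a q)) :=
  (multipliable_qPochInf hq a).hasProd.tendsto_prod_nat

@[simp]
theorem qPochInf_zero (q : ℂ) : qPochInf 0 q = 1 := by
  simp [qPochInf]

theorem qPochInf_eq_one_sub_mul (hq : ‖q‖ < 1) (a : ℂ) :
    qPochInf a q = (1 - a) * qPochInf (a * q) q := by
  have shift (n : ℕ) : 1 - a * q * q ^ n = 1 - a * q ^ (n + 1) := by ring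
  have h := tprod_eq_zero_mul' (f := fun n : ℕ => 1 - a * q ^ n)
    ((multipliable_qPochInf hq (a * q)).congr shift)
  simpa only [qPochInf, pow_zero, mul_one, tprod_congr shift] using h

theorem qPochInf_eq_prod_mul (hq : ‖q‖ < 1) (a : ℂ) (n : ℕ) :
    qPochInf a q = (∏ i ∈ Finset.range n, (1 - a * q ^ i)) * qPochInf (a * q ^ n) q := by
  induction n with
  | zero => simp
  | succ n ih =>
    rw [Finset.prod_range_succ, ih, qPochInf_eq_one_sub_mul hq (a * q ^ n), pow_succ]
    ring_nf

theorem qPochInf_ne_zero (hq : ‖q‖ < 1) {a : ℂ} (h : ∀ n : ℕ, a * q ^ n ≠ 1) :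
    qPochInf a q ≠ 0 := by
  have := tprod_one_add_ne_zero_of_summable (f := fun n : ℕ => -(a * q ^ n))
    (fun n => by simpa [← sub_eq_add_neg, sub_eq_zero] using (h n).symm)
    (summable_norm_mul_pow hq a)
  simpa [qPochInf, sub_eq_add_neg] using this

theorem qPochInf_ne_zero_of_norm_lt_one (hq : ‖q‖ < 1) {a : ℂ} (h : ‖a‖ < 1) :
    qPochInf a q ≠ 0 := by
  refine qPochInf_ne_zero hq fun n hn => ?_
  have hle : ‖a * q ^ n‖ ≤ ‖a‖ := by
    rw [norm_mul, norm_pow]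
    exact mul_le_of_le_one_right (norm_nonneg a) (pow_le_one₀ (norm_nonneg q) hq.le)
  rw [hn, norm_one] at hle
  exact hle.not_gt h

theorem differentiable_qPochInf (hq : ‖q‖ < 1) : Differentiable ℂ fun a => qPochInf a q := by
  have hprod : HasProdLocallyUniformlyOn (fun (n : ℕ) (a : ℂ) => 1 + -(a * q ^ n))
      (fun a => ∏' n : ℕ, (1 + -(a * q ^ n))) Set.univ := by
    refine hasProdLocallyUniformlyOn_of_forall_compact isOpen_univ fun K _ hK => ?_
    obtain ⟨R, hR⟩ := hK.isBounded.exists_norm_le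
    refine Summable.hasProdUniformlyOn_nat_one_add (u := fun n => R * ‖q‖ ^ n) hK
      ((summable_geometric_of_lt_one (norm_nonneg q) hq).mul_left R) (.of_forall fun n a ha => ?_)
      (fun n => by fun_prop)
    rw [norm_neg, norm_mul, norm_pow]
    gcongr
    exact hR a ha
  have hdiff := hprod.differentiableOn (.of_forall fun s => by fun_prop) isOpen_univ
  rw [← differentiableOn_univ]
  simpa [qPochInf, sub_eq_add_neg] using hdiff

theorem continuous_qPochInf (hq : ‖q‖ < 1) : Continuous fun a => qPochInf a q :=
  (differentiable_qPochInf hq).continuous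

theorem exists_norm_qPochInf_le (hq : ‖q‖ < 1) (R : ℝ) :
    ∃ B : ℝ, 0 < B ∧ ∀ a : ℂ, ‖a‖ ≤ R → ‖qPochInf a q‖ ≤ B := by
  obtain ⟨B, hB⟩ := (isCompact_closedBall (0 : ℂ) R).exists_bound_of_continuousOn
    (continuous_qPochInf hq).continuousOn
  exact ⟨max B 1, by positivity, fun a ha => (hB a (by simpa using ha)).trans (le_max_left _ _)⟩

end QPochhammer

section LineIntegral

open MeasureTheory Set Filter Topology

/-- `IsPiecewiseC1` for paths that need not be closed: the curves from which closed contours are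
assembled. -/
def PiecewiseC1Path {a b : ℂ} (γ : Path a b) : Prop :=
  ∃ P : Finset ℝ, ∀ u v : ℝ, 0 ≤ u → u < v → v ≤ 1 → (∀ t ∈ P, t ∉ Ioo u v) →
    ContDiffOn ℝ 1 γ.extend (Icc u v)

/-- `contourIntegral` for paths that need not be closed. -/
noncomputable def lineIntegral (f : ℂ → ℂ) {a b : ℂ} (γ : Path a b) : ℂ :=
  curveIntegral (fun z => f z • ContinuousLinearMap.id ℂ ℂ) γ

theorem contourIntegral_eq_lineIntegral (f : ℂ → ℂ) {p : ℂ} (γ : Path p p) :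
    contourIntegral f γ = lineIntegral f γ := rfl

theorem lineIntegral_eq_intervalIntegral (f : ℂ → ℂ) {a b : ℂ} (γ : Path a b) :
    lineIntegral f γ = ∫ t in (0 : ℝ)..1, f (γ.extend t) * deriv γ.extend t := by
  simp [lineIntegral, curveIntegral_eq_intervalIntegral_deriv]

theorem breakpoint_induction {motive : ℝ → ℝ → Prop} {P : Finset ℝ} {a b : ℝ} (hab : a < b)
    (trans : ∀ u t v, u < t → t < v → motive u t → motive t v → motive u v)
    (base : ∀ u v, a ≤ u → u < v → v ≤ b → (∀ t ∈ P, t ∉ Ioo u v) → motive u v) :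
    motive a b := by
  induction P using Finset.induction_on generalizing a b with
  | empty => exact base a b le_rfl hab le_rfl (by simp)
  | insert p P _ ih =>
    have of_notMem {u v : ℝ} (hau : a ≤ u) (hvb : v ≤ b) (huv : u < v) (hp : p ∉ Ioo u v) :
        motive u v := by
      refine ih huv fun u' v' hu huv' hv hP => base u' v' (hau.trans hu) huv' (hv.trans hvb) ?_
      exact (Finset.forall_mem_insert _ _ _).2 ⟨fun h => hp (Ioo_subset_Ioo hu hv h), hP⟩
    by_cases hp : p ∈ Ioo a b
    · exact trans a p b hp.1 hp.2 (of_notMem le_rfl hp.2.le hp.1 (by simp))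
        (of_notMem hp.1.le le_rfl hp.2 (by simp))
    · exact of_notMem le_rfl le_rfl hab hp

variable {a b c : ℂ} {γ : Path a b}

theorem path_extend_mem_range (γ : Path a b) (t : ℝ) : γ.extend t ∈ range γ :=
  γ.extend_range ▸ mem_range_self t

theorem continuous_comp_extend {f : ℂ → ℂ} (hf : ContinuousOn f (range γ)) :
    Continuous fun t => f (γ.extend t) :=
  hf.comp_continuous γ.continuous_extend (path_extend_mem_range γ)

namespace PiecewiseC1Path

theorem intervalIntegrable_deriv (hγ : PiecewiseC1Path γ) :
    IntervalIntegrable (deriv γ.extend) volume 0 1 := by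
  obtain ⟨P, hP⟩ := hγ
  refine breakpoint_induction (P := P) one_pos (fun _ _ _ _ _ => .trans) fun u v hu huv hv h => ?_
  have hwithin : IntervalIntegrable (derivWithin γ.extend (Icc u v)) volume u v :=
    ((hP u v hu huv hv h).continuousOn_derivWithin (uniqueDiffOn_Icc huv)
      le_rfl).intervalIntegrable_of_Icc huv.le
  refine hwithin.congr_ae ?_
  rw [uIoc_of_le huv.le, ← restrict_Ioo_eq_restrict_Ioc]
  filter_upwards [ae_restrict_mem measurableSet_Ioo] with x hx
  exact derivWithin_of_mem_nhds (Icc_mem_nhds hx.1 hx.2)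

theorem exists_differentiableAt (hγ : PiecewiseC1Path γ) :
    ∃ P : Finset ℝ, ∀ t ∈ Ioo (0 : ℝ) 1 \ (P : Set ℝ), DifferentiableAt ℝ γ.extend t := by
  obtain ⟨P, hP⟩ := hγ
  refine ⟨P, fun t ht => ?_⟩
  have hopen : IsOpen (Ioo (0 : ℝ) 1 \ (P : Set ℝ)) := isOpen_Ioo.sdiff P.finite_toSet.isClosed
  obtain ⟨ε, hε, hball⟩ := Metric.nhds_basis_closedBall.mem_iff.1 (hopen.mem_nhds ht)
  rw [Real.closedBall_eq_Icc] at hball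
  have hleft := hball (left_mem_Icc.2 (by linarith))
  have hright := hball (right_mem_Icc.2 (by linarith))
  have hC1 := hP (t - ε) (t + ε) hleft.1.1.le (by linarith) hright.1.2.le
    fun s hs hs' => (hball (Ioo_subset_Icc_self hs')).2 hs
  exact (hC1.differentiableOn one_ne_zero).differentiableAt
    (Icc_mem_nhds (by linarith) (by linarith))

theorem intervalIntegrable (hγ : PiecewiseC1Path γ) {f : ℂ → ℂ} (hf : ContinuousOn f (range γ)) :
    IntervalIntegrable (fun t => f (γ.extend t) * deriv γ.extend t) volume 0 1 :=
  hγ.intervalIntegrable_deriv.continuousOn_mul (continuous_comp_extend hf).continuousOn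

theorem curveIntegrable (hγ : PiecewiseC1Path γ) {f : ℂ → ℂ} (hf : ContinuousOn f (range γ)) :
    CurveIntegrable (fun z => f z • ContinuousLinearMap.id ℂ ℂ) γ := by
  refine (hγ.intervalIntegrable hf).congr_ae ?_
  rw [uIoc_of_le zero_le_one, ← restrict_Ioo_eq_restrict_Ioc]
  filter_upwards [ae_restrict_mem measurableSet_Ioo] with x hx
  rw [curveIntegralFun_def, derivWithin_of_mem_nhds (Icc_mem_nhds hx.1 hx.2)]
  simp

end PiecewiseC1Path

theorem lineIntegral_congr {f g : ℂ → ℂ} (h : ∀ z ∈ range γ, f z = g z) :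
    lineIntegral f γ = lineIntegral g γ := by
  simp only [lineIntegral_eq_intervalIntegral]
  exact intervalIntegral.integral_congr fun t _ => by simp only [h _ (path_extend_mem_range γ t)]

theorem lineIntegral_const_mul (k : ℂ) (f : ℂ → ℂ) (γ : Path a b) :
    lineIntegral (fun z => k * f z) γ = k * lineIntegral f γ := by
  simp only [lineIntegral_eq_intervalIntegral, mul_assoc, intervalIntegral.integral_const_mul]

theorem lineIntegral_add (hγ : PiecewiseC1Path γ) {f g : ℂ → ℂ} (hf : ContinuousOn f (range γ))
    (hg : ContinuousOn g (range γ)) :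
    lineIntegral (fun z => f z + g z) γ = lineIntegral f γ + lineIntegral g γ := by
  simp only [lineIntegral_eq_intervalIntegral, add_mul]
  exact intervalIntegral.integral_add (hγ.intervalIntegrable hf) (hγ.intervalIntegrable hg)

theorem lineIntegral_sub (hγ : PiecewiseC1Path γ) {f g : ℂ → ℂ} (hf : ContinuousOn f (range γ))
    (hg : ContinuousOn g (range γ)) :
    lineIntegral (fun z => f z - g z) γ = lineIntegral f γ - lineIntegral g γ := by
  simp only [lineIntegral_eq_intervalIntegral, sub_mul]
  exact intervalIntegral.integral_sub (hγ.intervalIntegrable hf) (hγ.intervalIntegrable hg)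

theorem lineIntegral_eq_sub_of_hasDerivAt (hγ : PiecewiseC1Path γ) {f F : ℂ → ℂ}
    (hf : ContinuousOn f (range γ)) (hF : ∀ z ∈ range γ, HasDerivAt F (f z) z) :
    lineIntegral f γ = F b - F a := by
  obtain ⟨P, hP⟩ := hγ.exists_differentiableAt
  have hFc : ContinuousOn F (range γ) := fun z hz => (hF z hz).continuousAt.continuousWithinAt
  rw [lineIntegral_eq_intervalIntegral, integral_eq_of_hasDerivAt_off_countable_of_le
    (fun t => F (γ.extend t)) _ zero_le_one P.countable_toSet
    (continuous_comp_extend hFc).continuousOn ?_ (hγ.intervalIntegrable hf)]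
  · rw [γ.extend_one, γ.extend_zero]
  · intro t ht
    exact (hF _ (path_extend_mem_range γ t)).comp_of_eq t (hP t ht).hasDerivAt rfl

theorem hasSum_lineIntegral (hγ : PiecewiseC1Path γ) {ι : Type*} [Countable ι] {F : ι → ℂ → ℂ}
    {u : ι → ℝ} (hu : Summable u) (hF : ∀ i, ContinuousOn (F i) (range γ))
    (hle : ∀ i, ∀ z ∈ range γ, ‖F i z‖ ≤ u i) :
    HasSum (fun i => lineIntegral (F i) γ) (lineIntegral (fun z => ∑' i, F i z) γ) := by
  simp only [lineIntegral_eq_intervalIntegral]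
  refine intervalIntegral.hasSum_integral_of_dominated_convergence
    (fun i t => u i * ‖deriv γ.extend t‖) (fun i => ?_) (fun i => .of_forall fun t _ => ?_)
    (.of_forall fun t _ => hu.mul_right _) ?_ (.of_forall fun t _ => ?_)
  · have := (hγ.intervalIntegrable (hF i)).aestronglyMeasurable
    rwa [uIoc_of_le zero_le_one]
  · rw [norm_mul]
    gcongr
    exact hle i _ (path_extend_mem_range γ t)
  · simp only [tsum_mul_right]
    exact hγ.intervalIntegrable_deriv.norm.const_mul _
  · exact (Summable.of_norm_bounded hu
      fun i => hle i _ (path_extend_mem_range γ t)).hasSum.mul_right _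

theorem tendsto_lineIntegral (hγ : PiecewiseC1Path γ) {F : ℕ → ℂ → ℂ} {f : ℂ → ℂ} {C : ℝ}
    (hF : ∀ n, ContinuousOn (F n) (range γ)) (hle : ∀ n, ∀ z ∈ range γ, ‖F n z‖ ≤ C)
    (hlim : ∀ z ∈ range γ, Tendsto (fun n => F n z) atTop (𝓝 (f z))) :
    Tendsto (fun n => lineIntegral (F n) γ) atTop (𝓝 (lineIntegral f γ)) := by
  simp only [lineIntegral_eq_intervalIntegral]
  refine intervalIntegral.tendsto_integral_filter_of_dominated_convergence
    (fun t => C * ‖deriv γ.extend t‖) (.of_forall fun n => ?_)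
    (.of_forall fun n => .of_forall fun t _ => ?_) (hγ.intervalIntegrable_deriv.norm.const_mul _)
    (.of_forall fun t _ => (hlim _ (path_extend_mem_range γ t)).mul_const _)
  · have := (hγ.intervalIntegrable (hF n)).aestronglyMeasurable
    rwa [uIoc_of_le zero_le_one]
  · rw [norm_mul]
    gcongr
    exact hle n _ (path_extend_mem_range γ t)

theorem lineIntegral_symm (f : ℂ → ℂ) (γ : Path a b) :
    lineIntegral f γ.symm = -lineIntegral f γ :=
  curveIntegral_symm _ _

theorem lineIntegral_trans {γ₁ : Path a b} {γ₂ : Path b c} (h₁ : PiecewiseC1Path γ₁)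
    (h₂ : PiecewiseC1Path γ₂) {f : ℂ → ℂ} (hf₁ : ContinuousOn f (range γ₁))
    (hf₂ : ContinuousOn f (range γ₂)) :
    lineIntegral f (γ₁.trans γ₂) = lineIntegral f γ₁ + lineIntegral f γ₂ :=
  curveIntegral_trans (h₁.curveIntegrable hf₁) (h₂.curveIntegrable hf₂)

theorem piecewiseC1Path_of_contDiffOn (h : ContDiffOn ℝ 1 γ.extend (Icc 0 1)) :
    PiecewiseC1Path γ :=
  ⟨∅, fun _ _ hu _ hv _ => h.mono (Icc_subset_Icc hu hv)⟩

theorem piecewiseC1Path_segment (a b : ℂ) : PiecewiseC1Path (Path.segment a b) := by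
  refine piecewiseC1Path_of_contDiffOn ?_
  have h : ContDiffOn ℝ 1 (fun t : ℝ => AffineMap.lineMap a b t) (Icc 0 1) := by
    simp only [AffineMap.lineMap_apply, vsub_eq_sub, vadd_eq_add]
    fun_prop
  exact h.congr fun t ht => by
    rw [Path.extend_apply _ ht]
    simp

/-- The image of a path under `z ↦ k z`, the change of variables that turns the poles of the
different summands into each other. -/
noncomputable def scalePath (k : ℂ) (γ : Path a b) : Path (k * a) (k * b) :=
  γ.map (continuous_const_mul k)

theorem scalePath_extend (k : ℂ) (γ : Path a b) :
    (scalePath k γ).extend = fun t => k * γ.extend t := rfl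

theorem lineIntegral_scalePath (f : ℂ → ℂ) (k : ℂ) (γ : Path a b) :
    lineIntegral f (scalePath k γ) = lineIntegral (fun z => k * f (k * z)) γ := by
  simp only [lineIntegral_eq_intervalIntegral, scalePath_extend, deriv_const_mul_field']
  exact intervalIntegral.integral_congr fun t _ => by ring

namespace PiecewiseC1Path

theorem scale (k : ℂ) (hγ : PiecewiseC1Path γ) : PiecewiseC1Path (scalePath k γ) := by
  obtain ⟨P, hP⟩ := hγ
  exact ⟨P, fun u v hu huv hv h => contDiffOn_const.mul (hP u v hu huv hv h)⟩

theorem symm (hγ : PiecewiseC1Path γ) : PiecewiseC1Path γ.symm := by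
  obtain ⟨P, hP⟩ := hγ
  refine ⟨P.image (1 - ·), fun u v hu huv hv h => ?_⟩
  rw [γ.extend_symm]
  refine (hP (1 - v) (1 - u) (by linarith) (by linarith) (by linarith) fun t ht ht' => ?_).comp
    (by fun_prop) fun t ht => ⟨by linarith [ht.2], by linarith [ht.1]⟩
  exact h (1 - t) (Finset.mem_image_of_mem _ ht) ⟨by linarith [ht'.2], by linarith [ht'.1]⟩

theorem trans {γ₁ : Path a b} {γ₂ : Path b c} (h₁ : PiecewiseC1Path γ₁)
    (h₂ : PiecewiseC1Path γ₂) : PiecewiseC1Path (γ₁.trans γ₂) := by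
  obtain ⟨P, hP⟩ := h₁
  obtain ⟨Q, hQ⟩ := h₂
  refine ⟨insert (1 / 2) (P.image (· / 2) ∪ Q.image fun t => (t + 1) / 2),
    fun u v hu huv hv h => ?_⟩
  simp only [Finset.forall_mem_insert, Finset.forall_mem_union, Finset.forall_mem_image] at h
  obtain ⟨hhalf, hPuv, hQuv⟩ := h
  rcases le_or_gt v (1 / 2) with hv' | hv'
  · have hC1 := (hP (2 * u) (2 * v) (by linarith) (by linarith) (by linarith) fun t ht ht' =>
      hPuv ht ⟨by linarith [ht'.1], by linarith [ht'.2]⟩).comp (f := fun t : ℝ => 2 * t)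
        (s := Icc u v) (by fun_prop) fun t ht => ⟨by linarith [ht.1], by linarith [ht.2]⟩
    exact hC1.congr fun t ht => Path.extend_trans_of_le_half _ _ (ht.2.trans hv')
  · have hu' : 1 / 2 ≤ u := le_of_not_gt fun hlt => hhalf ⟨hlt, hv'⟩
    have hC1 := (hQ (2 * u - 1) (2 * v - 1) (by linarith) (by linarith) (by linarith)
      fun t ht ht' => hQuv ht ⟨by linarith [ht'.1], by linarith [ht'.2]⟩).comp
        (f := fun t : ℝ => 2 * t - 1) (s := Icc u v) (by fun_prop)
        fun t ht => ⟨by linarith [ht.1], by linarith [ht.2]⟩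
    exact hC1.congr fun t ht => Path.extend_trans_of_half_le _ _ (hu'.trans ht.1)

end PiecewiseC1Path

end LineIntegral

section Cauchy

open MeasureTheory Set Metric

variable {p p' c w : ℂ} {γ : Path p p} {γ₁ : Path p p} {γ₂ : Path p' p'} {S : Set ℂ}

theorem continuousOn_sub_inv (hw : w ∉ S) : ContinuousOn (fun z : ℂ => (z - w)⁻¹) S :=
  (continuous_sub_right w).continuousOn.inv₀ fun _ hz h => hw (sub_eq_zero.1 h ▸ hz)

theorem continuousOn_prod_sub_inv {s : Multiset ℂ} (hw : ∀ w ∈ s, w ∉ S) :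
    ContinuousOn (fun z : ℂ => (s.map fun w => (z - w)⁻¹).prod) S := by
  induction s using Multiset.induction with
  | empty => simpa using continuousOn_const
  | cons w s ih =>
    simp only [Multiset.map_cons, Multiset.prod_cons]
    exact (continuousOn_sub_inv (hw w (by simp))).mul
      (ih fun v hv => hw v (Multiset.mem_cons_of_mem hv))

/-! ### Winding numbers -/

theorem lineIntegral_sub_inv (γ : Path p p) (w : ℂ) :
    lineIntegral (fun z => (z - w)⁻¹) γ = 2 * Real.pi * Complex.I * windingNumber γ w :=
  (mul_inv_cancel_left₀ Complex.two_pi_I_ne_zero _).symm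

theorem one_sub_mem_slitPlane {x : ℂ} (hx : ‖x‖ < 1) : 1 - x ∈ Complex.slitPlane := by
  simpa [sub_eq_add_neg] using Complex.mem_slitPlane_of_norm_lt_one (z := -x) (by simpa using hx)

theorem windingNumber_eq_zero_of_norm_lt (hγ : PiecewiseC1Path γ)
    (hw : ∀ z ∈ range γ, ‖z - c‖ < ‖w - c‖) : windingNumber γ w = 0 := by
  have hlog (z : ℂ) (hz : z ∈ range γ) :
      HasDerivAt (fun z => Complex.log (1 - (z - c) / (w - c))) (z - w)⁻¹ z := by
    have hwc : w - c ≠ 0 := norm_pos_iff.1 ((norm_nonneg _).trans_lt (hw z hz))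
    have hzw : z - w ≠ 0 := sub_ne_zero.2 fun h => (hw z hz).ne (by rw [h])
    have hslit : 1 - (z - c) / (w - c) ∈ Complex.slitPlane :=
      one_sub_mem_slitPlane (by rw [norm_div, div_lt_one (norm_pos_iff.2 hwc)]; exact hw z hz)
    have hderiv : -(1 / (w - c)) / (1 - (z - c) / (w - c)) = (z - w)⁻¹ := by
      rw [div_eq_iff (Complex.slitPlane_ne_zero hslit)]
      field_simp
      ring
    exact hderiv ▸ ((((hasDerivAt_id z).sub_const c).div_const (w - c)).const_sub 1).clog hslit
  refine (mul_eq_zero_iff_left Complex.two_pi_I_ne_zero).1 ?_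
  rw [← lineIntegral_sub_inv, lineIntegral_eq_sub_of_hasDerivAt hγ
    (continuousOn_sub_inv fun h => (hw w h).ne rfl) hlog, sub_self]

theorem windingNumber_eq_of_lt_norm (hγ : PiecewiseC1Path γ)
    (hw : ∀ z ∈ range γ, ‖w - c‖ < ‖z - c‖) : windingNumber γ w = windingNumber γ c := by
  have hlog (z : ℂ) (hz : z ∈ range γ) :
      HasDerivAt (fun z => Complex.log (1 - (w - c) / (z - c))) ((z - w)⁻¹ - (z - c)⁻¹) z := by
    have hzc : z - c ≠ 0 := norm_pos_iff.1 ((norm_nonneg _).trans_lt (hw z hz))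
    have hzw : z - w ≠ 0 := sub_ne_zero.2 fun h => (hw z hz).ne' (by rw [h])
    have hslit : 1 - (w - c) / (z - c) ∈ Complex.slitPlane :=
      one_sub_mem_slitPlane (by rw [norm_div, div_lt_one (norm_pos_iff.2 hzc)]; exact hw z hz)
    have hderiv : -((w - c) * -((z - c) ^ 2)⁻¹) / (1 - (w - c) / (z - c)) =
        (z - w)⁻¹ - (z - c)⁻¹ := by
      rw [div_eq_iff (Complex.slitPlane_ne_zero hslit)]
      field_simp
      ring
    exact hderiv ▸ (((((hasDerivAt_inv hzc).comp_sub_const z c).const_mul (w - c)).const_sub 1).clog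
      hslit)
  have hcw : ContinuousOn (fun z : ℂ => (z - w)⁻¹) (range γ) :=
    continuousOn_sub_inv fun h => (hw w h).ne rfl
  have hcc : ContinuousOn (fun z : ℂ => (z - c)⁻¹) (range γ) :=
    continuousOn_sub_inv fun h => (hw c h).not_ge (by simp)
  refine mul_left_cancel₀ Complex.two_pi_I_ne_zero ?_
  rw [← lineIntegral_sub_inv, ← lineIntegral_sub_inv, ← sub_eq_zero, ← lineIntegral_sub hγ hcw hcc,
    lineIntegral_eq_sub_of_hasDerivAt hγ (hcw.fun_sub hcc) hlog, sub_self]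

/-- Two closed piecewise `C¹` curves that avoid `S` and wind equally often around each of its
points: the hypothesis under which integrals with poles in `S` agree. -/
structure SameWinding (γ₁ : Path p p) (γ₂ : Path p' p') (S : Set ℂ) : Prop where
  piecewiseC1_left : PiecewiseC1Path γ₁
  piecewiseC1_right : PiecewiseC1Path γ₂
  notMem_left : ∀ w ∈ S, w ∉ range γ₁
  notMem_right : ∀ w ∈ S, w ∉ range γ₂
  winding : ∀ w ∈ S, windingNumber γ₁ w = windingNumber γ₂ w

theorem SameWinding.insert (hS : SameWinding γ₁ γ₂ S) (h₁ : w ∉ range γ₁) (h₂ : w ∉ range γ₂)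
    (hw : windingNumber γ₁ w = windingNumber γ₂ w) : SameWinding γ₁ γ₂ (insert w S) where
  piecewiseC1_left := hS.piecewiseC1_left
  piecewiseC1_right := hS.piecewiseC1_right
  notMem_left := forall_mem_insert.2 ⟨h₁, hS.notMem_left⟩
  notMem_right := forall_mem_insert.2 ⟨h₂, hS.notMem_right⟩
  winding := forall_mem_insert.2 ⟨hw, hS.winding⟩

/-! ### Rational functions -/

theorem lineIntegral_const_eq_zero (hγ : PiecewiseC1Path γ) (k : ℂ) :
    lineIntegral (fun _ => k) γ = 0 := by
  rw [lineIntegral_eq_sub_of_hasDerivAt hγ continuousOn_const fun z _ => hasDerivAt_const_mul k,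
    sub_self]

theorem lineIntegral_zpow_eq_zero (hγ : PiecewiseC1Path γ) (hc : c ∉ range γ) {n : ℤ}
    (hn : n ≠ -1) : lineIntegral (fun z => (z - c) ^ n) γ = 0 := by
  have hne (z : ℂ) (hz : z ∈ range γ) : z - c ≠ 0 := sub_ne_zero.2 fun h => hc (h ▸ hz)
  have hn' : (n + 1 : ℂ) ≠ 0 := by exact_mod_cast fun h : n + 1 = 0 => hn (by lia)
  have hderiv (z : ℂ) (hz : z ∈ range γ) :
      HasDerivAt (fun z => (z - c) ^ (n + 1) / (n + 1)) ((z - c) ^ n) z := by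
    have := ((hasDerivAt_zpow (n + 1) (z - c) (.inl (hne z hz))).comp_sub_const z c).div_const
      (n + 1 : ℂ)
    rwa [Int.cast_add, Int.cast_one, mul_div_cancel_left₀ _ hn', add_sub_cancel_right] at this
  rw [lineIntegral_eq_sub_of_hasDerivAt hγ ((continuous_sub_right c).continuousOn.zpow₀ n
    fun z hz => .inl (hne z hz)) hderiv, sub_self]

theorem eq_replicate_or_exists_cons_cons {α : Type*} (s : Multiset α) :
    s = 0 ∨ (∃ n a, s = Multiset.replicate (n + 1) a) ∨ ∃ a b t, a ≠ b ∧ s = a ::ₘ b ::ₘ t := by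
  induction s using Multiset.induction with
  | empty => exact .inl rfl
  | cons a t =>
    by_cases h : ∃ b ∈ t, b ≠ a
    · obtain ⟨b, hbt, hne⟩ := h
      obtain ⟨u, rfl⟩ := Multiset.exists_cons_of_mem hbt
      exact .inr (.inr ⟨a, b, u, hne.symm, rfl⟩)
    · push Not at h
      exact .inr (.inl ⟨t.card, a, by
        rw [Multiset.replicate_succ, ← Multiset.eq_replicate_card.2 h]⟩)

theorem prod_sub_inv_cons_cons {w' z : ℂ} (hne : w ≠ w') (hw : z ≠ w) (hw' : z ≠ w')
    (t : Multiset ℂ) :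
    ((w ::ₘ w' ::ₘ t).map fun v => (z - v)⁻¹).prod = (w - w')⁻¹ *
      (((w ::ₘ t).map fun v => (z - v)⁻¹).prod - ((w' ::ₘ t).map fun v => (z - v)⁻¹).prod) := by
  simp only [Multiset.map_cons, Multiset.prod_cons, ← sub_mul, ← mul_assoc]
  congr 1
  rw [inv_sub_inv (sub_ne_zero.2 hw) (sub_ne_zero.2 hw'), sub_sub_sub_cancel_left, ← mul_div_assoc,
    inv_mul_cancel₀ (sub_ne_zero.2 hne), one_div, mul_inv]

theorem lineIntegral_prod_sub_inv_cons_cons (hγ : PiecewiseC1Path γ) {w' : ℂ} (hne : w ≠ w')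
    {t : Multiset ℂ} (ht : ∀ v ∈ w ::ₘ w' ::ₘ t, v ∉ range γ) :
    lineIntegral (fun z => ((w ::ₘ w' ::ₘ t).map fun v => (z - v)⁻¹).prod) γ = (w - w')⁻¹ *
      (lineIntegral (fun z => ((w ::ₘ t).map fun v => (z - v)⁻¹).prod) γ -
        lineIntegral (fun z => ((w' ::ₘ t).map fun v => (z - v)⁻¹).prod) γ) := by
  simp only [Multiset.forall_mem_cons] at ht
  obtain ⟨hw, hw', ht⟩ := ht
  rw [← lineIntegral_sub hγ (continuousOn_prod_sub_inv (Multiset.forall_mem_cons.2 ⟨hw, ht⟩))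
    (continuousOn_prod_sub_inv (Multiset.forall_mem_cons.2 ⟨hw', ht⟩)), ← lineIntegral_const_mul]
  exact lineIntegral_congr fun z hz => prod_sub_inv_cons_cons hne (fun h => hw (h ▸ hz))
    (fun h => hw' (h ▸ hz)) t

theorem lineIntegral_prod_sub_inv_eq (hS : SameWinding γ₁ γ₂ S) {s : Multiset ℂ}
    (hs : ∀ w ∈ s, w ∈ S) :
    lineIntegral (fun z => (s.map fun w => (z - w)⁻¹).prod) γ₁ =
      lineIntegral (fun z => (s.map fun w => (z - w)⁻¹).prod) γ₂ := by
  induction s using Multiset.strongInductionOn with | ih s ih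
  obtain ⟨hγ₁, hγ₂, hw₁, hw₂, hw⟩ := hS
  rcases eq_replicate_or_exists_cons_cons s with rfl | ⟨n, w, rfl⟩ | ⟨w, w', t, hne, rfl⟩
  · simp only [Multiset.map_zero, Multiset.prod_zero, lineIntegral_const_eq_zero hγ₁,
      lineIntegral_const_eq_zero hγ₂]
  · have hwS : w ∈ S := hs w (by simp)
    simp only [Multiset.map_replicate, Multiset.prod_replicate]
    obtain rfl | hn := eq_or_ne n 0
    · simp only [zero_add, pow_one, lineIntegral_sub_inv, hw w hwS]
    · simp only [← zpow_natCast, inv_zpow']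
      rw [lineIntegral_zpow_eq_zero hγ₁ (hw₁ w hwS) (by lia),
        lineIntegral_zpow_eq_zero hγ₂ (hw₂ w hwS) (by lia)]
  · rw [lineIntegral_prod_sub_inv_cons_cons hγ₁ hne fun v hv => hw₁ v (hs v hv),
      lineIntegral_prod_sub_inv_cons_cons hγ₂ hne fun v hv => hw₂ v (hs v hv)]
    simp only [Multiset.forall_mem_cons] at hs
    obtain ⟨hwS, hwS', ht⟩ := hs
    rw [ih _ (Multiset.cons_swap w w' t ▸ Multiset.lt_cons_self _ _)
        (Multiset.forall_mem_cons.2 ⟨hwS, ht⟩),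
      ih _ (Multiset.lt_cons_self _ _) (Multiset.forall_mem_cons.2 ⟨hwS', ht⟩)]

/-! ### Cauchy's formula in an annulus -/

theorem circleIntegral_sub_inv_eq_zero {r : ℝ} (hr : 0 ≤ r) (hw : r < dist w c) :
    (∮ ζ in C(c, r), (ζ - w)⁻¹) = 0 := by
  refine Complex.circleIntegral_eq_zero_of_differentiable_on_off_countable hr countable_empty
    (continuousOn_sub_inv (by simpa using hw)) fun z hz => ?_
  have hzw : z - w ≠ 0 := sub_ne_zero.2 fun h => lt_asymm hw (h ▸ hz.1)
  fun_prop (disch := assumption)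

theorem circleIntegral_dslope {h : ℂ → ℂ} {ρ : ℝ} (hρ : 0 ≤ ρ) (hw : w ∉ sphere c ρ)
    (hh : ContinuousOn h (sphere c ρ)) :
    (∮ ζ in C(c, ρ), dslope h w ζ) =
      (∮ ζ in C(c, ρ), (ζ - w)⁻¹ * h ζ) - h w * ∮ ζ in C(c, ρ), (ζ - w)⁻¹ := by
  have hinv : ContinuousOn (fun ζ : ℂ => (ζ - w)⁻¹) (sphere c ρ) := continuousOn_sub_inv hw
  rw [← circleIntegral.integral_const_mul, ← circleIntegral.integral_sub
    ((hinv.fun_mul hh).circleIntegrable hρ)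
    ((continuousOn_const.fun_mul hinv).circleIntegrable hρ)]
  refine circleIntegral.integral_congr hρ fun z hz => ?_
  simp only [dslope_of_ne _ (ne_of_mem_of_not_mem hz hw), slope_def_field]
  ring

theorem circleIntegral_sub_circleIntegral_of_annulus {h : ℂ → ℂ} {r R : ℝ} (hr : 0 < r)
    (hw : w ∈ ball c R \ closedBall c r)
    (hh : ∀ z ∈ closedBall c R \ ball c r, DifferentiableAt ℂ h z) :
    (∮ ζ in C(c, R), (ζ - w)⁻¹ * h ζ) - (∮ ζ in C(c, r), (ζ - w)⁻¹ * h ζ) =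
      2 * Real.pi * Complex.I * h w := by
  have hwR : dist w c < R := hw.1
  have hrw : r < dist w c := not_le.1 hw.2
  have hrR : r < R := hrw.trans hwR
  have hannulus : ball c R \ closedBall c r ⊆ closedBall c R \ ball c r :=
    sdiff_subset_sdiff ball_subset_closedBall ball_subset_closedBall
  have hcont (ρ : ℝ) (hρ : ρ ∈ Icc r R) : ContinuousOn h (sphere c ρ) := fun z hz =>
    (hh z ⟨(mem_sphere.1 hz).trans_le hρ.2, fun hz' => hρ.1.not_gt
      ((mem_sphere.1 hz).symm.trans_lt hz')⟩).continuousAt.continuousWithinAt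
  have hslope : ∀ z ∈ closedBall c R \ ball c r, ContinuousAt (dslope h w) z := by
    intro z hz
    obtain rfl | hzw := eq_or_ne z w
    · exact continuousAt_dslope_same.2 (hh z hz)
    · exact (continuousAt_dslope_of_ne hzw).2 (hh z hz).continuousAt
  have hcauchy := Complex.circleIntegral_eq_of_differentiable_on_annulus_off_countable hr hrR.le
    (countable_singleton w) (fun z hz => (hslope z hz).continuousWithinAt)
    fun z hz => (differentiableAt_dslope_of_ne hz.2).2 (hh z (hannulus hz.1))
  rw [circleIntegral_dslope (hr.trans hrR).le (fun h => hwR.ne h) (hcont R ⟨hrR.le, le_rfl⟩),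
    circleIntegral_dslope hr.le (fun h => hrw.ne' h) (hcont r ⟨le_rfl, hrR.le⟩),
    circleIntegral.integral_sub_inv_of_mem_ball hw.1, circleIntegral_sub_inv_eq_zero hr.le hrw]
    at hcauchy
  linear_combination hcauchy

theorem lineIntegral_circleIntegral_swap (hγ : PiecewiseC1Path γ) {ρ : ℝ} (hρ : 0 ≤ ρ)
    {K : ℂ → ℂ → ℂ} (hK : ContinuousOn (Function.uncurry K) (sphere c ρ ×ˢ range γ)) :
    lineIntegral (fun w => ∮ ζ in C(c, ρ), K ζ w) γ = ∮ ζ in C(c, ρ), lineIntegral (K ζ) γ := by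
  simp only [lineIntegral_eq_intervalIntegral, circleIntegral, smul_eq_mul,
    ← intervalIntegral.integral_mul_const, ← intervalIntegral.integral_const_mul]
  rw [intervalIntegral_intervalIntegral_swap]
  · simp only [mul_assoc]
  have hcont : Continuous fun x : ℝ × ℝ =>
      deriv (circleMap c ρ) x.2 * K (circleMap c ρ x.2) (γ.extend x.1) := by
    simp only [deriv_circleMap]
    refine Continuous.mul (by fun_prop) ?_
    exact hK.comp_continuous (f := fun x : ℝ × ℝ => (circleMap c ρ x.2, γ.extend x.1))
      (by fun_prop) fun x => ⟨circleMap_mem_sphere c hρ x.2, path_extend_mem_range γ x.1⟩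
  have : IsFiniteMeasure (volume.restrict (uIoc 0 (2 * Real.pi))) := by
    rw [uIoc_of_le (by positivity)]
    infer_instance
  have hderiv : Integrable (fun x : ℝ × ℝ => deriv γ.extend x.1)
      ((volume.restrict (uIoc 0 1)).prod (volume.restrict (uIoc 0 (2 * Real.pi)))) :=
    (intervalIntegrable_iff.1 hγ.intervalIntegrable_deriv).comp_fst _
  obtain ⟨B, hB⟩ := ((isCompact_uIcc (a := (0 : ℝ)) (b := 1)).prod
    (isCompact_uIcc (a := (0 : ℝ)) (b := 2 * Real.pi))).exists_bound_of_continuousOn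
    hcont.continuousOn
  rw [IntegrableOn, Measure.volume_eq_prod, ← Measure.prod_restrict]
  refine Integrable.bdd_mul hderiv hcont.aestronglyMeasurable (c := B) ?_
  rw [Measure.prod_restrict]
  filter_upwards [ae_restrict_mem (measurableSet_uIoc.prod measurableSet_uIoc)] with x hx
  exact hB x ⟨uIoc_subset_uIcc hx.1, uIoc_subset_uIcc hx.2⟩

theorem continuousOn_cauchyKernel_mul {h : ℂ → ℂ} {U V : Set ℂ} (hUV : Disjoint U V)
    (hh : ContinuousOn h U) :
    ContinuousOn (fun x : ℂ × ℂ => (x.1 - x.2)⁻¹ * h x.1) (U ×ˢ V) := by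
  refine ContinuousOn.mul ((continuousOn_fst.sub continuousOn_snd).inv₀ fun x hx hx0 => ?_)
    (hh.comp continuousOn_fst fun x hx => hx.1)
  exact hUV.ne_of_mem hx.1 hx.2 (sub_eq_zero.1 hx0)

theorem continuousOn_circleIntegral {ρ : ℝ} (hρ : 0 ≤ ρ) {K : ℂ → ℂ → ℂ} {V : Set ℂ}
    (hK : ContinuousOn (Function.uncurry K) (sphere c ρ ×ˢ V)) :
    ContinuousOn (fun w => ∮ ζ in C(c, ρ), K ζ w) V := by
  rw [continuousOn_iff_continuous_domRestrict]
  simp only [circleIntegral, deriv_circleMap, smul_eq_mul, domRestrict_def]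
  refine intervalIntegral.continuous_parametric_intervalIntegral_of_continuous' ?_ 0 _
  simp only [Function.uncurry_def]
  refine Continuous.mul (by fun_prop) ?_
  exact hK.comp_continuous (f := fun x : V × ℝ => (circleMap c ρ x.2, (x.1 : ℂ)))
    (by fun_prop) fun x => ⟨circleMap_mem_sphere c hρ x.2, x.1.2⟩

theorem lineIntegral_circleIntegral_cauchyKernel_mul (hγ : PiecewiseC1Path γ) {h G : ℂ → ℂ}
    {ρ : ℝ} (hρ : 0 ≤ ρ) (hdisj : Disjoint (sphere c ρ) (range γ))
    (hh : ContinuousOn h (sphere c ρ)) (hG : ContinuousOn G (range γ)) :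
    lineIntegral (fun w => (∮ ζ in C(c, ρ), (ζ - w)⁻¹ * h ζ) * G w) γ =
      ∮ ζ in C(c, ρ), -h ζ * lineIntegral (fun w => (w - ζ)⁻¹ * G w) γ := by
  have hswap := lineIntegral_circleIntegral_swap hγ hρ (K := fun ζ w => (ζ - w)⁻¹ * h ζ * G w)
    ((continuousOn_cauchyKernel_mul hdisj hh).mul (hG.comp continuousOn_snd fun x hx => hx.2))
  simp only [mul_comm _ (G _), circleIntegral.integral_const_mul] at hswap ⊢
  rw [hswap]
  refine circleIntegral.integral_congr hρ fun ζ _ => ?_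
  rw [← lineIntegral_const_mul]
  refine lineIntegral_congr fun w _ => ?_
  rw [← neg_sub w ζ, inv_neg]
  ring

theorem lineIntegral_mul_eq_circleIntegral_sub (hγ : PiecewiseC1Path γ) {h G : ℂ → ℂ} {r R : ℝ}
    (hr : 0 < r) (hrR : r ≤ R) (hγr : range γ ⊆ ball c R \ closedBall c r)
    (hh : ∀ z ∈ closedBall c R \ ball c r, DifferentiableAt ℂ h z) (hG : ContinuousOn G (range γ)) :
    2 * Real.pi * Complex.I * lineIntegral (fun z => h z * G z) γ =
      (∮ ζ in C(c, R), -h ζ * lineIntegral (fun w => (w - ζ)⁻¹ * G w) γ) -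
        ∮ ζ in C(c, r), -h ζ * lineIntegral (fun w => (w - ζ)⁻¹ * G w) γ := by
  have hR : 0 ≤ R := hr.le.trans hrR
  have hdisjR : Disjoint (sphere c R) (range γ) :=
    disjoint_left.2 fun z hz hz' => (mem_ball.1 (hγr hz').1).ne hz
  have hdisjr : Disjoint (sphere c r) (range γ) :=
    disjoint_left.2 fun z hz hz' => (hγr hz').2 (sphere_subset_closedBall hz)
  have hhR : ContinuousOn h (sphere c R) := fun z hz =>
    (hh z ⟨sphere_subset_closedBall hz, fun hz' => (mem_sphere.1 hz ▸ mem_ball.1 hz').not_ge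
      hrR⟩).continuousAt.continuousWithinAt
  have hhr : ContinuousOn h (sphere c r) := fun z hz =>
    (hh z ⟨(mem_sphere.1 hz).trans_le hrR, fun hz' => (mem_ball.1 hz').ne
      hz⟩).continuousAt.continuousWithinAt
  have hcont {ρ : ℝ} (hρ : 0 ≤ ρ) (hdisj : Disjoint (sphere c ρ) (range γ))
      (hhρ : ContinuousOn h (sphere c ρ)) :
      ContinuousOn (fun w => (∮ ζ in C(c, ρ), (ζ - w)⁻¹ * h ζ) * G w) (range γ) :=
    (continuousOn_circleIntegral hρ (K := fun ζ w => (ζ - w)⁻¹ * h ζ)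
      (continuousOn_cauchyKernel_mul hdisj hhρ)).mul hG
  rw [← lineIntegral_circleIntegral_cauchyKernel_mul hγ hR hdisjR hhR hG,
    ← lineIntegral_circleIntegral_cauchyKernel_mul hγ hr.le hdisjr hhr hG,
    ← lineIntegral_sub hγ (hcont hR hdisjR hhR) (hcont hr.le hdisjr hhr), ← lineIntegral_const_mul]
  refine lineIntegral_congr fun w hw => ?_
  rw [← sub_mul, circleIntegral_sub_circleIntegral_of_annulus hr (hγr hw) hh]
  ring

theorem lineIntegral_sub_inv_mul_prod_sub_inv_eq (hS : SameWinding γ₁ γ₂ S) {r R : ℝ}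
    (hγ₁ : range γ₁ ⊆ ball c R \ closedBall c r) (hγ₂ : range γ₂ ⊆ ball c R \ closedBall c r)
    (hc : c ∈ S) {s : Multiset ℂ} (hs : ∀ w ∈ s, w ∈ S) {ζ : ℂ}
    (hζ : ζ ∉ ball c R \ closedBall c r) :
    lineIntegral (fun w => (w - ζ)⁻¹ * (s.map fun v => (w - v)⁻¹).prod) γ₁ =
      lineIntegral (fun w => (w - ζ)⁻¹ * (s.map fun v => (w - v)⁻¹).prod) γ₂ := by
  have hwinding : windingNumber γ₁ ζ = windingNumber γ₂ ζ := by
    by_cases hr : ζ ∈ closedBall c r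
    · have hlt {z : ℂ} (hz : z ∈ ball c R \ closedBall c r) : ‖ζ - c‖ < ‖z - c‖ := by
        simpa only [← dist_eq_norm] using (mem_closedBall.1 hr).trans_lt (not_le.1 hz.2)
      rw [windingNumber_eq_of_lt_norm hS.piecewiseC1_left fun z hz => hlt (hγ₁ hz),
        windingNumber_eq_of_lt_norm hS.piecewiseC1_right fun z hz => hlt (hγ₂ hz), hS.winding c hc]
    · have hlt {z : ℂ} (hz : z ∈ ball c R \ closedBall c r) : ‖z - c‖ < ‖ζ - c‖ := by
        simpa only [← dist_eq_norm] using (mem_ball.1 hz.1).trans_le (not_lt.1 fun h => hζ ⟨h, hr⟩)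
      rw [windingNumber_eq_zero_of_norm_lt hS.piecewiseC1_left fun z hz => hlt (hγ₁ hz),
        windingNumber_eq_zero_of_norm_lt hS.piecewiseC1_right fun z hz => hlt (hγ₂ hz)]
  have hS' := hS.insert (fun h => hζ (hγ₁ h)) (fun h => hζ (hγ₂ h)) hwinding
  simpa only [Multiset.map_cons, Multiset.prod_cons] using lineIntegral_prod_sub_inv_eq hS'
    (s := ζ ::ₘ s) (Multiset.forall_mem_cons.2 ⟨mem_insert _ _, fun w hw => .inr (hs w hw)⟩)

theorem lineIntegral_mul_prod_sub_inv_eq (hS : SameWinding γ₁ γ₂ S) {h : ℂ → ℂ} {r R : ℝ}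
    (hr : 0 < r) (hrR : r ≤ R) (hγ₁ : range γ₁ ⊆ ball c R \ closedBall c r)
    (hγ₂ : range γ₂ ⊆ ball c R \ closedBall c r)
    (hh : ∀ z ∈ closedBall c R \ ball c r, DifferentiableAt ℂ h z)
    (hc : c ∈ S) {s : Multiset ℂ} (hs : ∀ w ∈ s, w ∈ S) :
    lineIntegral (fun z => h z * (s.map fun w => (z - w)⁻¹).prod) γ₁ =
      lineIntegral (fun z => h z * (s.map fun w => (z - w)⁻¹).prod) γ₂ := by
  have hcircle {ρ : ℝ} (hρ : 0 ≤ ρ) (hdisj : ∀ ζ ∈ sphere c ρ, ζ ∉ ball c R \ closedBall c r) :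
      (∮ ζ in C(c, ρ), -h ζ *
        lineIntegral (fun w => (w - ζ)⁻¹ * (s.map fun v => (w - v)⁻¹).prod) γ₁) =
      ∮ ζ in C(c, ρ), -h ζ *
        lineIntegral (fun w => (w - ζ)⁻¹ * (s.map fun v => (w - v)⁻¹).prod) γ₂ :=
    circleIntegral.integral_congr hρ fun ζ hζ => by
      simp only [lineIntegral_sub_inv_mul_prod_sub_inv_eq hS hγ₁ hγ₂ hc hs (hdisj ζ hζ)]
  refine mul_left_cancel₀ Complex.two_pi_I_ne_zero ?_
  rw [lineIntegral_mul_eq_circleIntegral_sub hS.piecewiseC1_left hr hrR hγ₁ hh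
      (continuousOn_prod_sub_inv fun w hw => hS.notMem_left w (hs w hw)),
    lineIntegral_mul_eq_circleIntegral_sub hS.piecewiseC1_right hr hrR hγ₂ hh
      (continuousOn_prod_sub_inv fun w hw => hS.notMem_right w (hs w hw)),
    hcircle (hr.le.trans hrR) fun ζ hζ hζ' => (mem_ball.1 hζ'.1).ne hζ,
    hcircle hr.le fun ζ hζ hζ' => hζ'.2 (sphere_subset_closedBall hζ)]

/-! ### Functions with finitely many poles -/

/-- `f` is on `U` the product of a holomorphic function and of finitely many factors `(z - w)⁻¹`
with `w ∈ S`, counted with multiplicity: the functions to which Cauchy's theorem is applied. -/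
def HasFinitePoles (f : ℂ → ℂ) (U S : Set ℂ) : Prop :=
  ∃ (h : ℂ → ℂ) (s : Multiset ℂ), (∀ z ∈ U, DifferentiableAt ℂ h z) ∧ (∀ w ∈ s, w ∈ S) ∧
    ∀ z ∈ U, f z = h z * (s.map fun w => (z - w)⁻¹).prod

variable {f g : ℂ → ℂ} {U : Set ℂ}

theorem HasFinitePoles.of_differentiableAt (hf : ∀ z ∈ U, DifferentiableAt ℂ f z) :
    HasFinitePoles f U S :=
  ⟨f, 0, hf, by simp, by simp⟩

theorem HasFinitePoles.sub_inv (hw : w ∈ S) : HasFinitePoles (fun z => (z - w)⁻¹) U S :=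
  ⟨fun _ => 1, {w}, fun _ _ => differentiableAt_const 1, by simpa using hw, by simp⟩

theorem HasFinitePoles.mul (hf : HasFinitePoles f U S) (hg : HasFinitePoles g U S) :
    HasFinitePoles (fun z => f z * g z) U S := by
  obtain ⟨h, s, hh, hs, hfz⟩ := hf
  obtain ⟨h', s', hh', hs', hgz⟩ := hg
  refine ⟨fun z => h z * h' z, s + s', fun z hz => (hh z hz).fun_mul (hh' z hz),
    fun w hw => (Multiset.mem_add.1 hw).elim (hs w) (hs' w), fun z hz => ?_⟩
  beta_reduce
  rw [hfz z hz, hgz z hz, Multiset.map_add, Multiset.prod_add, mul_mul_mul_comm]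

theorem HasFinitePoles.finsetProd {ι : Type*} (t : Finset ι) {F : ι → ℂ → ℂ}
    (hF : ∀ i ∈ t, HasFinitePoles (F i) U S) : HasFinitePoles (fun z => ∏ i ∈ t, F i z) U S := by
  classical
  induction t using Finset.induction with
  | empty => exact .of_differentiableAt fun z _ => by simp
  | insert i t hi ih =>
    simp only [Finset.prod_insert hi]
    exact (hF i (Finset.mem_insert_self i t)).mul
      (ih fun j hj => hF j (Finset.mem_insert_of_mem hj))

theorem HasFinitePoles.congr (hg : HasFinitePoles g U S) (h : ∀ z ∈ U, f z = g z) :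
    HasFinitePoles f U S := by
  obtain ⟨k, s, hk, hs, hgz⟩ := hg
  exact ⟨k, s, hk, hs, fun z hz => (h z hz).trans (hgz z hz)⟩

theorem exists_range_subset_annulus (γ : Path p p) (hc : c ∉ range γ) :
    ∃ r R : ℝ, 0 < r ∧ range γ ⊆ ball c R \ closedBall c r := by
  have hγ : IsCompact (range γ) := isCompact_range γ.continuous
  obtain ⟨R, hR⟩ := hγ.isBounded.subset_ball c
  obtain ⟨z₀, hz₀, hmin⟩ := hγ.exists_isMinOn (range_nonempty γ)
    (continuous_id.dist continuous_const : Continuous fun z => dist z c).continuousOn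
  have hpos : 0 < dist z₀ c := dist_pos.2 (ne_of_mem_of_not_mem hz₀ hc)
  exact ⟨dist z₀ c / 2, R, half_pos hpos, fun z hz => ⟨hR hz, fun h =>
    ((mem_closedBall.1 h).trans_lt (half_lt_self hpos)).not_ge (hmin hz)⟩⟩

theorem lineIntegral_eq_of_hasFinitePoles (hS : SameWinding γ₁ γ₂ S) (hc : c ∈ S)
    (hf : ∀ r R : ℝ, 0 < r → HasFinitePoles f (closedBall c R \ ball c r) S) :
    lineIntegral f γ₁ = lineIntegral f γ₂ := by
  obtain ⟨r₁, R₁, hr₁, hγ₁⟩ := exists_range_subset_annulus γ₁ (hS.notMem_left c hc)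
  obtain ⟨r₂, R₂, hr₂, hγ₂⟩ := exists_range_subset_annulus γ₂ (hS.notMem_right c hc)
  set r := min r₁ r₂
  set R := max R₁ R₂
  have hr : 0 < r := lt_min hr₁ hr₂
  replace hγ₁ : range γ₁ ⊆ ball c R \ closedBall c r := hγ₁.trans (sdiff_subset_sdiff
    (ball_subset_ball (le_max_left _ _)) (closedBall_subset_closedBall (min_le_left _ _)))
  replace hγ₂ : range γ₂ ⊆ ball c R \ closedBall c r := hγ₂.trans (sdiff_subset_sdiff
    (ball_subset_ball (le_max_right _ _)) (closedBall_subset_closedBall (min_le_right _ _)))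
  have hrR : r ≤ R := by
    obtain ⟨hR, hr⟩ := hγ₁ (mem_range_self 0)
    exact (not_le.1 hr).le.trans (mem_ball.1 hR).le
  have hsub : ball c R \ closedBall c r ⊆ closedBall c R \ ball c r :=
    sdiff_subset_sdiff ball_subset_closedBall ball_subset_closedBall
  obtain ⟨h, s, hh, hs, hfz⟩ := hf r R hr
  rw [lineIntegral_congr fun z hz => hfz z (hsub (hγ₁ hz)),
    lineIntegral_congr fun z hz => hfz z (hsub (hγ₂ hz))]
  exact lineIntegral_mul_prod_sub_inv_eq hS hr hrR hγ₁ hγ₂ hh hc hs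

end Cauchy

section SeparatingContours

open Metric

variable {ι : Type*} {q : ℂ} {b c : ι → ℂ} {p p' : ℂ} {γ : Path p p} {γ₁ : Path p p}
  {γ₂ : Path p' p'} {S T U : Set ℂ}

theorem IsSeparatingContour.sameWinding (h₁ : IsSeparatingContour γ₁ S T)
    (h₂ : IsSeparatingContour γ₂ S T) : SameWinding γ₁ γ₂ (S ∪ T) where
  piecewiseC1_left := h₁.piecewiseC1
  piecewiseC1_right := h₂.piecewiseC1
  notMem_left := by
    rintro _ hw ⟨t, rfl⟩
    exact hw.elim (h₁.avoids_inside t) (h₁.avoids_outside t)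
  notMem_right := by
    rintro _ hw ⟨t, rfl⟩
    exact hw.elim (h₂.avoids_inside t) (h₂.avoids_outside t)
  winding w hw := hw.elim
    (fun hw => (h₁.winding_inside w hw).trans (h₂.winding_inside w hw).symm)
    fun hw => (h₁.winding_outside w hw).trans (h₂.winding_outside w hw).symm

/-- The product `(b z, c / z; q)_∞`, the building block of the denominators below. -/
noncomputable def qPochPair (q b c z : ℂ) : ℂ := qPochInf (b * z) q * qPochInf (c / z) q

/-- The zeros `c_j q ^ k` of the factors `(c_j / z; q)_∞`, together with their limit `0`. -/
def innerPoles (q : ℂ) (c : ι → ℂ) : Set ℂ :=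
  {z | z = 0 ∨ ∃ (j : ι) (k : ℕ), z = c j * q ^ k}

/-- The zeros `q ^ (-k) / b_j` of the factors `(b_j z; q)_∞`. -/
def outerPoles (q : ℂ) (b : ι → ℂ) : Set ℂ :=
  {z | ∃ (j : ι) (k : ℕ), b j * z * q ^ k = 1}

theorem zero_mem_innerPoles (q : ℂ) (c : ι → ℂ) : 0 ∈ innerPoles q c := .inl rfl

theorem qPochPair_ne_zero (hq : ‖q‖ < 1) {z : ℂ} (hc : z ∉ innerPoles q c)
    (hb : z ∉ outerPoles q b) (j : ι) : qPochPair q (b j) (c j) z ≠ 0 := by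
  have hz : z ≠ 0 := fun h => hc (.inl h)
  refine mul_ne_zero (qPochInf_ne_zero hq fun n hn => hb ⟨j, n, hn⟩)
    (qPochInf_ne_zero hq fun n hn => hc (.inr ⟨j, n, ?_⟩))
  rw [div_mul_eq_mul_div, div_eq_one_iff_eq hz] at hn
  exact hn.symm

theorem exists_qPochInf_mul_pow_ne_zero (hq : ‖q‖ < 1) (M : ℝ) :
    ∃ K : ℕ, ∀ a : ℂ, ‖a‖ ≤ M → qPochInf (a * q ^ K) q ≠ 0 := by
  obtain ⟨K, hK⟩ := (((tendsto_pow_atTop_nhds_zero_of_lt_one (norm_nonneg q) hq).const_mul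
    M).eventually_lt_const (u := 1) (by simp)).exists
  refine ⟨K, fun a ha => qPochInf_ne_zero_of_norm_lt_one hq (lt_of_le_of_lt ?_ hK)⟩
  rw [norm_mul, norm_pow]
  gcongr

theorem HasFinitePoles.inv_qPochInf (hq : ‖q‖ < 1) {f : ℂ → ℂ} {M : ℝ}
    (hfM : ∀ z ∈ U, ‖f z‖ ≤ M) (hf : ∀ z ∈ U, DifferentiableAt ℂ f z)
    (hS : ∀ k : ℕ, HasFinitePoles (fun z => (1 - f z * q ^ k)⁻¹) U S) :
    HasFinitePoles (fun z => (qPochInf (f z) q)⁻¹) U S := by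
  obtain ⟨K, hK⟩ := exists_qPochInf_mul_pow_ne_zero hq M
  have htail : HasFinitePoles (fun z => (qPochInf (f z * q ^ K) q)⁻¹) U S :=
    .of_differentiableAt fun z hz => ((differentiable_qPochInf hq _).fun_comp' z
      ((hf z hz).mul_const (q ^ K))).fun_inv (hK _ (hfM z hz))
  refine ((HasFinitePoles.finsetProd (Finset.range K) fun k _ => hS k).mul htail).congr
    fun z _ => ?_
  rw [qPochInf_eq_prod_mul hq (f z) K, mul_inv, Finset.prod_inv_distrib]

theorem HasFinitePoles.inv_one_sub_mul {b : ℂ} (hS : ∀ z, b * z = 1 → z ∈ S) :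
    HasFinitePoles (fun z => (1 - b * z)⁻¹) U S := by
  obtain rfl | hb := eq_or_ne b 0
  · exact .of_differentiableAt fun z _ => by simp
  · refine ((HasFinitePoles.of_differentiableAt fun z _ => differentiableAt_const (-b⁻¹)).mul
      (.sub_inv (hS b⁻¹ (mul_inv_cancel₀ hb)))).congr fun z _ => ?_
    rw [← inv_neg, ← mul_inv, mul_sub, neg_mul, neg_mul, mul_inv_cancel₀ hb]
    ring

theorem HasFinitePoles.inv_one_sub_div {c : ℂ} (h0 : (0 : ℂ) ∉ U) (hc : c ∈ S) :
    HasFinitePoles (fun z => (1 - c / z)⁻¹) U S := by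
  refine ((HasFinitePoles.of_differentiableAt fun z _ => differentiableAt_id).mul
    (.sub_inv hc)).congr fun z hz => ?_
  rw [one_sub_div (ne_of_mem_of_not_mem hz h0), inv_div, div_eq_mul_inv, id]

theorem hasFinitePoles_inv_qPochPair (hq : ‖q‖ < 1) (j : ι) {r : ℝ} (hr : 0 < r) (R : ℝ) :
    HasFinitePoles (fun z => (qPochPair q (b j) (c j) z)⁻¹) (closedBall 0 R \ ball 0 r)
      (innerPoles q c ∪ outerPoles q b) := by
  have hne : (0 : ℂ) ∉ closedBall 0 R \ ball 0 r := fun h => h.2 (mem_ball_self hr)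
  have hzero (z : ℂ) (hz : z ∈ closedBall (0 : ℂ) R \ ball 0 r) : z ≠ 0 :=
    ne_of_mem_of_not_mem hz hne
  have hb : HasFinitePoles (fun z => (qPochInf (b j * z) q)⁻¹) (closedBall 0 R \ ball 0 r)
      (innerPoles q c ∪ outerPoles q b) := by
    refine .inv_qPochInf hq (M := ‖b j‖ * R) (fun z hz => ?_) (fun z _ => by fun_prop) fun k => ?_
    · rw [norm_mul]
      gcongr
      exact mem_closedBall_zero_iff.1 hz.1
    · simp only [mul_right_comm (b j) _ (q ^ k)]
      exact .inv_one_sub_mul fun z hz => .inr ⟨j, k, by rw [← hz, mul_right_comm]⟩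
  have hc : HasFinitePoles (fun z => (qPochInf (c j / z) q)⁻¹) (closedBall 0 R \ ball 0 r)
      (innerPoles q c ∪ outerPoles q b) := by
    refine .inv_qPochInf hq (M := ‖c j‖ / r) (fun z hz => ?_)
      (fun z hz => by fun_prop (disch := exact hzero z hz)) fun k => ?_
    · rw [norm_div]
      gcongr
      exact not_lt.1 fun h => hz.2 (mem_ball_zero_iff.2 h)
    · simp only [div_mul_eq_mul_div]
      exact .inv_one_sub_div hne (.inl (.inr ⟨j, k, rfl⟩))
  simpa only [qPochPair, mul_inv] using hb.mul hc

variable [Fintype ι]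

theorem lineIntegral_eq_of_isSeparatingContour (hq : ‖q‖ < 1)
    (h₁ : IsSeparatingContour γ₁ (innerPoles q c) (outerPoles q b))
    (h₂ : IsSeparatingContour γ₂ (innerPoles q c) (outerPoles q b)) {N : ℂ → ℂ}
    (hN : ∀ z ≠ 0, DifferentiableAt ℂ N z) :
    lineIntegral (fun z => N z / ∏ j, qPochPair q (b j) (c j) z) γ₁ =
      lineIntegral (fun z => N z / ∏ j, qPochPair q (b j) (c j) z) γ₂ := by
  refine lineIntegral_eq_of_hasFinitePoles (h₁.sameWinding h₂)
    (.inl (zero_mem_innerPoles q c)) fun r R hr => ?_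
  have hnum : HasFinitePoles N (closedBall 0 R \ ball 0 r) (innerPoles q c ∪ outerPoles q b) :=
    .of_differentiableAt fun z hz => hN z fun h => hz.2 (h ▸ mem_ball_self hr)
  refine (hnum.mul (.finsetProd Finset.univ fun j _ =>
    hasFinitePoles_inv_qPochPair hq j hr R)).congr fun z _ => ?_
  rw [div_eq_mul_inv, Finset.prod_inv_distrib]

end SeparatingContours

section ContourExistence

open MeasureTheory Set Metric Filter Topology

variable {p c v w x : ℂ} {S T N : Set ℂ}

/-- The circle `t ↦ c + v exp (2 π i t)` around `c`, based at `c + v`. -/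
noncomputable def circleLoop (c v : ℂ) : Path (c + v) (c + v) where
  toFun t := c + v * Complex.exp (2 * Real.pi * Complex.I * (t : ℝ))
  continuous_toFun := by fun_prop
  source' := by simp
  target' := by simp [Complex.exp_two_pi_mul_I]

theorem circleLoop_extend {t : ℝ} (ht : t ∈ Icc (0 : ℝ) 1) :
    (circleLoop c v).extend t = c + v * Complex.exp (2 * Real.pi * Complex.I * t) := by
  rw [Path.extend_apply _ ht]
  rfl

theorem norm_sub_of_mem_range_circleLoop {z : ℂ} (hz : z ∈ range (circleLoop c v)) :
    ‖z - c‖ = ‖v‖ := by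
  obtain ⟨t, rfl⟩ := hz
  have hexp : circleLoop c v t - c =
      v * Complex.exp ((2 * Real.pi * (t : ℝ) : ℝ) * Complex.I) := by
    change c + v * Complex.exp (2 * Real.pi * Complex.I * (t : ℝ)) - c = _
    rw [add_sub_cancel_left]
    push_cast
    ring_nf
  rw [hexp, norm_mul, Complex.norm_exp_ofReal_mul_I, mul_one]

theorem piecewiseC1Path_circleLoop (c v : ℂ) : PiecewiseC1Path (circleLoop c v) := by
  have hcast : ContDiff ℝ 1 fun t : ℝ => (t : ℂ) := Complex.ofRealCLM.contDiff
  have hexp : ContDiffOn ℝ 1 (fun t : ℝ => c + v * Complex.exp (2 * Real.pi * Complex.I * t))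
      (Icc 0 1) := by fun_prop
  exact piecewiseC1Path_of_contDiffOn (hexp.congr fun t ht => circleLoop_extend ht)

theorem deriv_circleLoop_extend {t : ℝ} (ht : t ∈ Ioo (0 : ℝ) 1) :
    deriv (circleLoop c v).extend t =
      2 * Real.pi * Complex.I * ((circleLoop c v).extend t - c) := by
  have hloc : (circleLoop c v).extend =ᶠ[𝓝 t]
      fun t => c + v * Complex.exp (2 * Real.pi * Complex.I * t) := by
    filter_upwards [Icc_mem_nhds ht.1 ht.2] with s hs using circleLoop_extend hs
  have hcast : HasDerivAt (fun t : ℝ => (t : ℂ)) 1 t := Complex.ofRealCLM.hasDerivAt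
  rw [hloc.deriv_eq, circleLoop_extend (Ioo_subset_Icc_self ht),
    ((((hcast.const_mul (2 * Real.pi * Complex.I)).cexp).const_mul v).const_add c).deriv]
  ring

theorem windingNumber_circleLoop_center (c : ℂ) (hv : v ≠ 0) :
    windingNumber (circleLoop c v) c = 1 := by
  have hconst : lineIntegral (fun z => (z - c)⁻¹) (circleLoop c v) =
      ∫ _ in (0 : ℝ)..1, (2 * Real.pi * Complex.I : ℂ) := by
    rw [lineIntegral_eq_intervalIntegral]
    refine intervalIntegral.integral_congr_ae_restrict ?_
    rw [uIoc_of_le zero_le_one, ← restrict_Ioo_eq_restrict_Ioc]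
    filter_upwards [ae_restrict_mem measurableSet_Ioo] with t ht
    have hne : (circleLoop c v).extend t - c ≠ 0 := norm_pos_iff.1 <|
      norm_sub_of_mem_range_circleLoop (path_extend_mem_range (circleLoop c v) t) ▸
        norm_pos_iff.2 hv
    rw [deriv_circleLoop_extend ht, mul_comm, mul_inv_cancel_right₀ hne]
  rw [lineIntegral_sub_inv, intervalIntegral.integral_const, sub_zero, one_smul] at hconst
  exact mul_left_cancel₀ Complex.two_pi_I_ne_zero (hconst.trans (mul_one _).symm)

theorem windingNumber_circleLoop_of_norm_lt (hw : ‖w - c‖ < ‖v‖) :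
    windingNumber (circleLoop c v) w = 1 := by
  rw [windingNumber_eq_of_lt_norm (piecewiseC1Path_circleLoop c v)
    fun z hz => by rwa [norm_sub_of_mem_range_circleLoop hz],
    windingNumber_circleLoop_center c (norm_pos_iff.1 ((norm_nonneg _).trans_lt hw))]

theorem windingNumber_circleLoop_of_lt_norm (hw : ‖v‖ < ‖w - c‖) :
    windingNumber (circleLoop c v) w = 0 :=
  windingNumber_eq_zero_of_norm_lt (piecewiseC1Path_circleLoop c v)
    fun z hz => by rwa [norm_sub_of_mem_range_circleLoop hz]

theorem windingNumber_trans {γ₁ γ₂ : Path p p} (h₁ : PiecewiseC1Path γ₁) (h₂ : PiecewiseC1Path γ₂)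
    (hw₁ : w ∉ range γ₁) (hw₂ : w ∉ range γ₂) :
    windingNumber (γ₁.trans γ₂) w = windingNumber γ₁ w + windingNumber γ₂ w := by
  simp only [windingNumber, contourIntegral_eq_lineIntegral, ← mul_add,
    lineIntegral_trans h₁ h₂ (continuousOn_sub_inv hw₁) (continuousOn_sub_inv hw₂)]

/-- The loop at `p` that goes straight to `c + v`, around `circleLoop c v`, and back. -/
noncomputable def lasso (p c v : ℂ) : Path p p :=
  ((Path.segment p (c + v)).trans (circleLoop c v)).trans (Path.segment p (c + v)).symm

theorem piecewiseC1Path_lasso (p c v : ℂ) : PiecewiseC1Path (lasso p c v) :=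
  ((piecewiseC1Path_segment _ _).trans (piecewiseC1Path_circleLoop c v)).trans
    (piecewiseC1Path_segment _ _).symm

theorem range_lasso (p c v : ℂ) :
    range (lasso p c v) = range (Path.segment p (c + v)) ∪ range (circleLoop c v) := by
  rw [lasso, Path.trans_range, Path.trans_range, Path.symm_range, union_right_comm, union_self]

theorem windingNumber_lasso (hw : w ∉ range (lasso p c v)) :
    windingNumber (lasso p c v) w = windingNumber (circleLoop c v) w := by
  have hrange := range_lasso p c v
  rw [hrange, mem_union, not_or] at hw
  have hseg := continuousOn_sub_inv hw.1
  have hcirc := continuousOn_sub_inv hw.2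
  have hα := piecewiseC1Path_segment p (c + v)
  have hδ := piecewiseC1Path_circleLoop c v
  simp only [windingNumber, contourIntegral_eq_lineIntegral]
  rw [lasso, lineIntegral_trans (hα.trans hδ) hα.symm
      (by rw [Path.trans_range]; exact continuousOn_sub_inv (not_or.2 hw))
      (by rwa [Path.symm_range]),
    lineIntegral_trans hα hδ hseg hcirc, lineIntegral_symm, add_neg_cancel_comm]

/-- Different displacements perpendicular to `w - p` give segments which meet only at `p`, so only
countably many of them are excluded. -/
theorem exists_segment_avoiding (hN : N.Countable) (hp : p ∉ N) (hw : w ≠ p) {ε : ℝ}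
    (hε : 0 < ε) :
    ∃ v : ℂ, v ≠ 0 ∧ ‖v‖ < ε ∧ ∀ x ∈ N, x ∉ range (Path.segment p (w + v)) := by
  have hwp : w - p ≠ 0 := sub_ne_zero.2 hw
  have hpos : 0 < ‖w - p‖ := norm_pos_iff.2 hwp
  obtain ⟨η, hηN, hη, hηε⟩ := ((hN.image fun x => ((x - p) / (w - p)).im /
    ((x - p) / (w - p)).re).dense_compl ℝ).exists_mem_open isOpen_Ioo
    (nonempty_Ioo.2 (div_pos hε hpos))
  refine ⟨η * Complex.I * (w - p), by simp [hη.ne', hwp], ?_, ?_⟩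
  · rw [norm_mul, norm_mul, Complex.norm_I, mul_one, Complex.norm_real, Real.norm_of_nonneg hη.le]
    exact (lt_div_iff₀ hpos).1 hηε
  · rintro x hx ⟨t, rfl⟩
    have hratio : (Path.segment p (w + η * Complex.I * (w - p)) t - p) / (w - p) =
        (t : ℝ) * (1 + η * Complex.I) := by
      rw [div_eq_iff hwp, Path.segment_apply, AffineMap.lineMap_apply, vsub_eq_sub, vadd_eq_add,
        add_sub_cancel_right, Complex.real_smul]
      ring
    have ht : (t : ℝ) ≠ 0 := fun ht => hp <| by
      rw [ht, Complex.ofReal_zero, zero_mul, div_eq_zero_iff, sub_eq_zero, sub_eq_zero] at hratio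
      exact hratio.resolve_right hw ▸ hx
    refine hηN ⟨_, hx, ?_⟩
    beta_reduce
    rw [hratio]
    simp [ht]

theorem exists_loop_around (hN : N.Countable) (hp : p ∉ N) (hw : w ∈ N)
    (hiso : ∀ᶠ x in 𝓝[≠] w, x ∉ N) :
    ∃ γ : Path p p, PiecewiseC1Path γ ∧ (∀ x ∈ N, x ∉ range γ) ∧
      ∀ x ∈ N, windingNumber γ x = ({w} : Set ℂ).indicator 1 x := by
  obtain ⟨ε, hε, hball⟩ := Metric.eventually_nhds_iff.1 (eventually_nhdsWithin_iff.1 hiso)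
  obtain ⟨v, hv, hvε, hseg⟩ := exists_segment_avoiding hN hp (ne_of_mem_of_not_mem hw hp) hε
  have hfar (x : ℂ) (hx : x ∈ N) (hxw : x ≠ w) : ‖v‖ < ‖x - w‖ := by
    refine hvε.trans_le (not_lt.1 fun h => ?_)
    exact hball (dist_eq_norm x w ▸ h) hxw hx
  have hcirc (x : ℂ) (hx : x ∈ N) (hxr : x ∈ range (circleLoop w v)) : False := by
    have hnorm := norm_sub_of_mem_range_circleLoop hxr
    refine (hfar x hx ?_).ne' hnorm
    rintro rfl
    exact hv (norm_eq_zero.1 (by rw [← hnorm, sub_self, norm_zero]))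
  have hrange (x : ℂ) (hx : x ∈ N) : x ∉ range (lasso p w v) := by
    rw [range_lasso]
    exact not_or.2 ⟨hseg x hx, hcirc x hx⟩
  refine ⟨lasso p w v, piecewiseC1Path_lasso p w v, hrange, fun x hx => ?_⟩
  rw [windingNumber_lasso (hrange x hx)]
  obtain rfl | hxw := eq_or_ne x w
  · rw [indicator_of_mem (mem_singleton x), Pi.one_apply,
      windingNumber_circleLoop_center x hv]
  · rw [indicator_of_notMem (notMem_singleton_iff.2 hxw),
      windingNumber_circleLoop_of_lt_norm (hfar x hx hxw)]

theorem exists_loop_around_finite (hN : N.Countable) (hp : p ∉ N) {γ₀ : Path p p}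
    (h₀ : PiecewiseC1Path γ₀) (hγ₀ : ∀ x ∈ N, x ∉ range γ₀) {A : Set ℂ} (hA : A.Finite)
    (hAN : A ⊆ N) (hiso : ∀ w ∈ A, ∀ᶠ x in 𝓝[≠] w, x ∉ N) :
    ∃ γ : Path p p, PiecewiseC1Path γ ∧ (∀ x ∈ N, x ∉ range γ) ∧
      ∀ x ∈ N, windingNumber γ x = windingNumber γ₀ x + A.indicator 1 x := by
  induction A, hA using Set.Finite.induction_on with
  | empty => exact ⟨γ₀, h₀, hγ₀, by simp⟩
  | @insert w A hwA _ ih =>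
    obtain ⟨hw, hAN⟩ := insert_subset_iff.1 hAN
    obtain ⟨hisow, hiso⟩ := forall_mem_insert.1 hiso
    obtain ⟨γ, hγ, hγN, hwind⟩ := ih hAN hiso
    obtain ⟨δ, hδ, hδN, hwindδ⟩ := exists_loop_around hN hp hw hisow
    refine ⟨γ.trans δ, hγ.trans hδ, fun x hx => ?_, fun x hx => ?_⟩
    · rw [Path.trans_range]
      exact not_or.2 ⟨hγN x hx, hδN x hx⟩
    · rw [windingNumber_trans hγ hδ (hγN x hx) (hδN x hx), hwind x hx, hwindδ x hx, insert_eq,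
        indicator_union_of_disjoint (disjoint_singleton_left.2 hwA)]
      ring

theorem countable_of_finite_sdiff_ball (hS : ∀ r : ℝ, 0 < r → (S \ ball 0 r).Finite) :
    S.Countable := by
  refine ((countable_singleton (0 : ℂ)).union (countable_iUnion fun n : ℕ =>
    (hS (n + 1 : ℝ)⁻¹ (by positivity)).countable)).mono fun z hz => ?_
  obtain rfl | hz0 := eq_or_ne z 0
  · exact .inl rfl
  · obtain ⟨n, hn⟩ := exists_nat_one_div_lt (norm_pos_iff.2 hz0)
    rw [one_div] at hn
    exact .inr (mem_iUnion.2 ⟨n, hz, fun h => (mem_ball_zero_iff.1 h).not_gt hn⟩)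

theorem countable_of_finite_inter_closedBall (hT : ∀ R : ℝ, (T ∩ closedBall 0 R).Finite) :
    T.Countable := by
  refine (countable_iUnion fun n : ℕ => (hT n).countable).mono fun z hz => ?_
  obtain ⟨n, hn⟩ := exists_nat_ge ‖z‖
  exact mem_iUnion.2 ⟨n, hz, mem_closedBall_zero_iff.2 hn⟩

theorem eventually_nhdsNE_notMem_union (hS : ∀ r : ℝ, 0 < r → (S \ ball 0 r).Finite)
    (hT : ∀ R : ℝ, (T ∩ closedBall 0 R).Finite) (hw : w ≠ 0) : ∀ᶠ x in 𝓝[≠] w, x ∉ S ∪ T := by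
  have hpos : 0 < ‖w‖ := norm_pos_iff.2 hw
  have hfin := ((hS _ (half_pos hpos)).union (hT (‖w‖ + 1))).sdiff (t := {w})
  rw [eventually_nhdsWithin_iff]
  filter_upwards [hfin.isClosed.isOpen_compl.mem_nhds (x := w) (by simp),
    continuous_norm.continuousAt.eventually_const_lt (half_lt_self hpos),
    continuous_norm.continuousAt.eventually_lt_const (lt_add_one ‖w‖)] with x hx hlow hup hxw hxN
  exact hx ⟨hxN.imp (fun h => ⟨h, fun hb => (mem_ball_zero_iff.1 hb).not_gt hlow⟩)
    fun h => ⟨h, mem_closedBall_zero_iff.2 hup.le⟩, hxw⟩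

theorem exists_pos_forall_le_norm (hT : ∀ R : ℝ, (T ∩ closedBall 0 R).Finite)
    (h0 : (0 : ℂ) ∉ T) : ∃ ε : ℝ, 0 < ε ∧ ∀ z ∈ T, ε ≤ ‖z‖ := by
  obtain ⟨ε, hε, hball⟩ := Metric.mem_nhds_iff.1
    ((hT 1).isClosed.isOpen_compl.mem_nhds (x := 0) fun h => h0 h.1)
  refine ⟨min ε 1, lt_min hε one_pos, fun z hz => not_lt.1 fun hlt => ?_⟩
  rw [lt_min_iff] at hlt
  exact hball (mem_ball_zero_iff.2 hlt.1) ⟨hz, mem_closedBall_zero_iff.2 hlt.2.le⟩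

/-- A small circle around `0` has the right winding number around all points except for the
finitely many points of `S` outside of it, which are then encircled one by one. -/
theorem exists_isSeparatingContour (hS : ∀ r : ℝ, 0 < r → (S \ ball 0 r).Finite)
    (hT : ∀ R : ℝ, (T ∩ closedBall 0 R).Finite) (hST : Disjoint S T) (h0 : (0 : ℂ) ∉ T) :
    ∃ (p : ℂ) (γ : Path p p), IsSeparatingContour γ S T := by
  have hN : (S ∪ T).Countable :=
    (countable_of_finite_sdiff_ball hS).union (countable_of_finite_inter_closedBall hT)
  obtain ⟨ε, hε, hTε⟩ := exists_pos_forall_le_norm hT h0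
  obtain ⟨r, hrN, hr, hrε⟩ := ((hN.image (‖·‖)).dense_compl ℝ).exists_mem_open
    isOpen_Ioo (nonempty_Ioo.2 hε)
  have hnorm : ‖(r : ℂ)‖ = r := by rw [Complex.norm_real, Real.norm_of_nonneg hr.le]
  have hneN (x : ℂ) (hx : x ∈ S ∪ T) : ‖x‖ ≠ r := fun h => hrN ⟨x, hx, h⟩
  have hout (x : ℂ) (hx : r < ‖x‖) : windingNumber (circleLoop 0 r) x = 0 :=
    windingNumber_circleLoop_of_lt_norm (by rwa [sub_zero, hnorm])
  obtain ⟨γ, hγ, hγN, hwind⟩ := exists_loop_around_finite (p := 0 + r) hN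
    (fun h => hneN _ h (by rw [zero_add, hnorm])) (piecewiseC1Path_circleLoop 0 r)
    (fun x hx hxr => hneN x hx (by rw [← hnorm, ← norm_sub_of_mem_range_circleLoop hxr, sub_zero]))
    (hS r hr) (sdiff_subset.trans subset_union_left)
    fun w hw => eventually_nhdsNE_notMem_union hS hT fun h => hw.2 (h ▸ mem_ball_self hr)
  refine ⟨0 + r, γ, hγ, fun t ht => hγN _ (.inl ht) ⟨t, rfl⟩,
    fun t ht => hγN _ (.inr ht) ⟨t, rfl⟩, fun w hw => ?_, fun w hw => ?_⟩
  · rw [hwind w (.inl hw)]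
    obtain hlt | hgt := (hneN w (.inl hw)).lt_or_gt
    · rw [windingNumber_circleLoop_of_norm_lt (by rwa [sub_zero, hnorm]),
        indicator_of_notMem fun h => h.2 (mem_ball_zero_iff.2 hlt), add_zero]
    · have hmem : w ∈ S \ ball 0 r := ⟨hw, fun h => (mem_ball_zero_iff.1 h).not_gt hgt⟩
      rw [hout w hgt, indicator_of_mem hmem, Pi.one_apply, zero_add]
  · rw [hwind w (.inr hw), hout w (hrε.trans_le (hTε w hw)),
      indicator_of_notMem fun h => hST.notMem_of_mem_left h.1 hw, zero_add]

section Poles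

variable {ι : Type*} {q : ℂ} {b c : ι → ℂ}

theorem zero_notMem_outerPoles (q : ℂ) (b : ι → ℂ) : (0 : ℂ) ∉ outerPoles q b := by
  rintro ⟨j, k, h⟩
  simp at h

theorem disjoint_innerPoles_outerPoles (h : ∀ j k (n : ℕ), b j * c k * q ^ n ≠ 1) :
    Disjoint (innerPoles q c) (outerPoles q b) := by
  refine disjoint_left.2 ?_
  rintro _ (rfl | ⟨k, n, rfl⟩) hz
  · exact zero_notMem_outerPoles q b hz
  · obtain ⟨j, m, hm⟩ := hz
    exact h j k (n + m) (by rw [pow_add, ← hm]; ring)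

variable [Finite ι]

theorem finite_innerPoles_sdiff_ball (hq : ‖q‖ < 1) (c : ι → ℂ) {r : ℝ} (hr : 0 < r) :
    (innerPoles q c \ ball 0 r).Finite := by
  have hlim (j : ι) : Tendsto (fun K => ‖c j * q ^ K‖) atTop (𝓝 0) := by
    simpa using ((tendsto_pow_atTop_nhds_zero_of_norm_lt_one hq).const_mul (c j)).norm
  obtain ⟨K, hK⟩ := eventually_atTop.1
    (eventually_all.2 fun j => (hlim j).eventually_lt_const hr)
  refine ((finite_univ (α := ι).prod (finite_Iio K)).image fun x => c x.1 * q ^ x.2).subset ?_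
  rintro _ ⟨rfl | ⟨j, k, rfl⟩, hz⟩
  · exact absurd (mem_ball_self hr) hz
  · exact ⟨(j, k), ⟨mem_univ j, not_le.1 fun hk => hz (mem_ball_zero_iff.2 (hK k hk j))⟩, rfl⟩

theorem finite_outerPoles_inter_closedBall (hq : ‖q‖ < 1) (b : ι → ℂ) (R : ℝ) :
    (outerPoles q b ∩ closedBall 0 R).Finite := by
  refine ((finite_innerPoles_sdiff_ball hq b (r := (|R| + 1)⁻¹) (by positivity)).image
    (·⁻¹)).subset ?_
  rintro z ⟨⟨j, k, hz⟩, hzR⟩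
  rw [mul_right_comm] at hz
  refine ⟨b j * q ^ k, ⟨.inr ⟨j, k, rfl⟩, fun hsmall => ?_⟩, inv_eq_of_mul_eq_one_right hz⟩
  have hzR' : ‖z‖ ≤ |R| := (mem_closedBall_zero_iff.1 hzR).trans (le_abs_self R)
  have hlt : ‖b j * q ^ k‖ * (|R| + 1) < 1 := by
    rwa [mem_ball_zero_iff, ← one_div, lt_div_iff₀ (by positivity)] at hsmall
  have hone : ‖b j * q ^ k‖ * ‖z‖ = 1 := by rw [← norm_mul, hz, norm_one]
  nlinarith [norm_nonneg (b j * q ^ k)]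

theorem exists_isSeparatingContour_innerPoles_outerPoles (hq : ‖q‖ < 1)
    (h : ∀ j k (n : ℕ), b j * c k * q ^ n ≠ 1) :
    ∃ (p : ℂ) (γ : Path p p), IsSeparatingContour γ (innerPoles q c) (outerPoles q b) :=
  exists_isSeparatingContour (fun _ hr => finite_innerPoles_sdiff_ball hq c hr)
    (finite_outerPoles_inter_closedBall hq b) (disjoint_innerPoles_outerPoles h)
    (zero_notMem_outerPoles q b)

end Poles

theorem windingNumber_scalePath {k : ℂ} (hk : k ≠ 0) (γ : Path p p) (w : ℂ) :
    windingNumber (scalePath k γ) (k * w) = windingNumber γ w := by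
  simp only [windingNumber, contourIntegral_eq_lineIntegral, lineIntegral_scalePath, ← mul_sub,
    mul_inv, mul_inv_cancel_left₀ hk]

theorem IsSeparatingContour.scale {γ : Path p p} {k : ℂ} (hk : k ≠ 0) {S' T' : Set ℂ}
    (h : IsSeparatingContour γ S T) (hS : ∀ z, k * z ∈ S' ↔ z ∈ S) (hT : ∀ z, k * z ∈ T' ↔ z ∈ T) :
    IsSeparatingContour (scalePath k γ) S' T' where
  piecewiseC1 := PiecewiseC1Path.scale k h.piecewiseC1
  avoids_inside t ht := h.avoids_inside t ((hS _).1 ht)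
  avoids_outside t ht := h.avoids_outside t ((hT _).1 ht)
  winding_inside w hw := by
    rw [← mul_inv_cancel_left₀ hk w] at hw ⊢
    rw [windingNumber_scalePath hk, h.winding_inside _ ((hS _).1 hw)]
  winding_outside w hw := by
    rw [← mul_inv_cancel_left₀ hk w] at hw ⊢
    rw [windingNumber_scalePath hk, h.winding_outside _ ((hT _).1 hw)]

end ContourExistence

section BilateralSeries

variable {q x : ℂ}

theorem qPochPair_inv (q b c z : ℂ) : qPochPair q b c z⁻¹ = qPochPair q c b z := by
  rw [qPochPair, qPochPair, div_inv_eq_mul, ← div_eq_mul_inv, mul_comm]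

theorem qPochPair_eq_one_sub_mul_mul (hq : ‖q‖ < 1) (b c z : ℂ) :
    qPochPair q b c z = (1 - b * z) * qPochPair q (q * b) c z := by
  rw [qPochPair, qPochPair, qPochInf_eq_one_sub_mul hq (b * z), mul_assoc,
    show b * z * q = q * b * z by ring]

theorem qPochPair_eq_one_sub_div_mul (hq : ‖q‖ < 1) (b c z : ℂ) :
    qPochPair q b c z = (1 - c / z) * qPochPair q b (q * c) z := by
  rw [qPochPair, qPochPair, qPochInf_eq_one_sub_mul hq (c / z), mul_left_comm,
    show c / z * q = q * c / z by ring]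

theorem qPochPair_mul_mul (hq0 : q ≠ 0) (b c z : ℂ) :
    qPochPair q b (q * c) (q * z) = qPochPair q (q * b) c z := by
  rw [qPochPair, qPochPair, mul_div_mul_left c z hq0, show b * (q * z) = q * b * z by ring]

theorem qPochInf_mul_div_pow (hq : ‖q‖ < 1) (hq0 : q ≠ 0) (w : ℂ) (n : ℕ) :
    qPochInf (q * w / q ^ n) q = (∏ i ∈ Finset.range n, (1 - w / q ^ i)) * qPochInf (q * w) q := by
  induction n with
  | zero => simp
  | succ n ih =>
    rw [pow_succ', mul_div_mul_left w _ hq0, qPochInf_eq_one_sub_mul hq,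
      show w / q ^ n * q = q * w / q ^ n by ring, ih, Finset.prod_range_succ]
    ring

theorem prod_one_add_mul_pow_le {t A : ℝ} (ht0 : 0 ≤ t) (ht : t < 1) (hA : 0 ≤ A) (n : ℕ) :
    ∏ i ∈ Finset.range n, (1 + A * t ^ i) ≤ Real.exp (A * (1 - t)⁻¹) := by
  refine (Real.prod_one_add_le_exp_sum _ fun i => by positivity).trans (Real.exp_le_exp.2 ?_)
  rw [← Finset.mul_sum, ← tsum_geometric_of_lt_one ht0 ht]
  gcongr
  exact (summable_geometric_of_lt_one ht0 ht).sum_le_tsum _ fun i _ => by positivity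

theorem norm_prod_one_sub_div_pow_le (hq : ‖q‖ < 1) (hq0 : q ≠ 0) {w : ℂ} {W : ℝ} (hW : 0 < W)
    (hw : ‖w‖ ≤ W) (n : ℕ) :
    ‖∏ i ∈ Finset.range n, (1 - w / q ^ i)‖ ≤
      Real.exp (W⁻¹ * (1 - ‖q‖)⁻¹) * (W ^ n * (∏ i ∈ Finset.range n, ‖q‖ ^ i)⁻¹) := by
  have hqpos : 0 < ‖q‖ := norm_pos_iff.2 hq0
  have hfactor (i : ℕ) : ‖1 - w / q ^ i‖ ≤ (1 + W⁻¹ * ‖q‖ ^ i) * (W * (‖q‖ ^ i)⁻¹) :=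
    calc ‖1 - w / q ^ i‖ ≤ 1 + W / ‖q‖ ^ i := by
          refine (norm_sub_le _ _).trans ?_
          rw [norm_one, norm_div, norm_pow]
          gcongr
      _ = (1 + W⁻¹ * ‖q‖ ^ i) * (W * (‖q‖ ^ i)⁻¹) := by field_simp; ring
  calc ‖∏ i ∈ Finset.range n, (1 - w / q ^ i)‖
      ≤ ∏ i ∈ Finset.range n, ((1 + W⁻¹ * ‖q‖ ^ i) * (W * (‖q‖ ^ i)⁻¹)) := by
        rw [norm_prod]
        exact Finset.prod_le_prod (fun _ _ => norm_nonneg _) fun i _ => hfactor i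
    _ = (∏ i ∈ Finset.range n, (1 + W⁻¹ * ‖q‖ ^ i)) *
          (W ^ n * (∏ i ∈ Finset.range n, ‖q‖ ^ i)⁻¹) := by
        rw [Finset.prod_mul_distrib, Finset.prod_mul_distrib, Finset.prod_const, Finset.card_range,
          Finset.prod_inv_distrib]
    _ ≤ _ := by
        gcongr
        exact prod_one_add_mul_pow_le hqpos.le hq (inv_nonneg.2 hW.le) n

theorem exists_norm_qPochPair_pow_mul_le (hq : ‖q‖ < 1) (hq0 : q ≠ 0) {A r : ℝ} (hA : 0 < A)
    (hr : 0 < r) (R : ℝ) : ∃ M : ℝ, 0 < M ∧ ∀ (n : ℕ) (a x : ℂ), ‖a‖ ≤ A → r ≤ ‖x‖ → ‖x‖ ≤ R →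
      ‖qPochPair q (q * a) (q * a) (q ^ n * x)‖ ≤
        M * ((A / ‖x‖) ^ n * (∏ i ∈ Finset.range n, ‖q‖ ^ i)⁻¹) := by
  obtain ⟨B₁, hB₁, h₁⟩ := exists_norm_qPochInf_le hq (A * R)
  obtain ⟨B₂, hB₂, h₂⟩ := exists_norm_qPochInf_le hq (A / r)
  refine ⟨B₁ * (Real.exp (R / A * (1 - ‖q‖)⁻¹) * B₂), by positivity, fun n a x ha hxr hxR => ?_⟩
  have hxpos : 0 < ‖x‖ := hr.trans_le hxr
  have hfst : ‖q * a * (q ^ n * x)‖ ≤ A * R :=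
    calc ‖q * a * (q ^ n * x)‖ = ‖q‖ ^ (n + 1) * (‖a‖ * ‖x‖) := by
          simp only [norm_mul, norm_pow]
          ring
      _ ≤ 1 * (A * R) := by
          gcongr
          exact pow_le_one₀ (norm_nonneg q) hq.le
      _ = A * R := one_mul _
  have hsnd : ‖q * (a / x)‖ ≤ A / r := by
    rw [norm_mul, norm_div]
    exact (mul_le_of_le_one_left (by positivity) hq.le).trans (by gcongr)
  have hprod : ‖∏ i ∈ Finset.range n, (1 - a / x / q ^ i)‖ ≤ Real.exp (R / A * (1 - ‖q‖)⁻¹) *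
      ((A / ‖x‖) ^ n * (∏ i ∈ Finset.range n, ‖q‖ ^ i)⁻¹) := by
    refine (norm_prod_one_sub_div_pow_le hq hq0 (W := A / ‖x‖) (by positivity)
      (by rw [norm_div]; gcongr) n).trans ?_
    rw [inv_div]
    have : 0 ≤ (1 - ‖q‖)⁻¹ := inv_nonneg.2 (sub_nonneg.2 hq.le)
    gcongr
  rw [qPochPair, show q * a / (q ^ n * x) = q * (a / x) / q ^ n by ring,
    qPochInf_mul_div_pow hq hq0, norm_mul, norm_mul]
  calc _ ≤ B₁ * (Real.exp (R / A * (1 - ‖q‖)⁻¹) *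
        ((A / ‖x‖) ^ n * (∏ i ∈ Finset.range n, ‖q‖ ^ i)⁻¹) * B₂) := by
        gcongr
        exacts [h₁ _ hfst, h₂ _ hsnd]
    _ = _ := by ring

/-- The infinite products and the power of `x` common to `poisedTerm` and `poisedCert`, which differ
from it by polynomial factors in `q ^ m * x` and its inverse. -/
noncomputable def poisedCore (q : ℂ) (c : Fin 4 → ℂ) (m : ℤ) (x : ℂ) : ℂ :=
  (∏ j, qPochPair q (q * c j) (q * c j) (q ^ m * x)) * (q ^ (2 * m ^ 2 - m) * x ^ (4 * m))

/-- The terms of the very-well-poised bilateral series `₆ψ₆` with parameters `c_j`, normalized so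
that they are entire in the `c_j`. -/
noncomputable def poisedTerm (q : ℂ) (c : Fin 4 → ℂ) (m : ℤ) (x : ℂ) : ℂ :=
  (1 - (q ^ m * x) ^ 2) * poisedCore q c m x

/-- The sequence whose differences are the error terms in the contiguous relation for
`poisedTerm`. -/
noncomputable def poisedCert (q : ℂ) (c : Fin 4 → ℂ) (m : ℤ) (x : ℂ) : ℂ :=
  (∏ j, (1 - c j * (q ^ m * x))) * (q ^ m * x)⁻¹ * poisedCore q c m x

theorem poisedCore_neg (hq0 : q ≠ 0) (c : Fin 4 → ℂ) (m : ℤ) (x : ℂ) :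
    poisedCore q c (-m) x = (q ^ m) ^ 2 * poisedCore q c m x⁻¹ := by
  have hy : q ^ (-m) * x = (q ^ m * x⁻¹)⁻¹ := by rw [mul_inv, inv_inv, zpow_neg]
  have hpow : q ^ (2 * (-m) ^ 2 - -m) = (q ^ m) ^ 2 * q ^ (2 * m ^ 2 - m) := by
    rw [← zpow_natCast, ← zpow_mul, ← zpow_add₀ hq0]
    congr 1
    push_cast
    ring
  simp only [poisedCore, hy, qPochPair_inv, hpow]
  rw [inv_zpow', show 4 * -m = -(4 * m) by ring]
  ring

theorem poisedTerm_neg (hq0 : q ≠ 0) (c : Fin 4 → ℂ) (m : ℤ) (hx : x ≠ 0) :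
    poisedTerm q c (-m) x = -x ^ 2 * poisedTerm q c m x⁻¹ := by
  have hqm : q ^ m ≠ 0 := zpow_ne_zero m hq0
  rw [poisedTerm, poisedTerm, poisedCore_neg hq0 c m x, zpow_neg]
  field_simp
  ring

theorem poisedCert_add_one (hq : ‖q‖ < 1) (hq0 : q ≠ 0) (c : Fin 4 → ℂ) (m : ℤ) (hx : x ≠ 0) :
    poisedCert q c (m + 1) x =
      (∏ j, (1 - c j / (q ^ m * x))) * (q ^ m * x) ^ 3 * poisedCore q c m x := by
  have hqm : q ^ m ≠ 0 := zpow_ne_zero m hq0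
  have hy : q ^ (m + 1) * x = q * (q ^ m * x) := by
    rw [zpow_add_one₀ hq0]
    ring
  have hpow : q ^ (2 * (m + 1) ^ 2 - (m + 1)) = q ^ (2 * m ^ 2 - m) * ((q ^ m) ^ 4 * q) := by
    rw [← zpow_natCast (q ^ m), ← zpow_mul, ← zpow_add_one₀ hq0, ← zpow_add₀ hq0]
    congr 1
    push_cast
    ring
  have hxpow : x ^ (4 * (m + 1)) = x ^ (4 * m) * x ^ 4 := by
    rw [mul_add, mul_one, zpow_add₀ hx]
    rfl
  have hprod : (∏ j, (1 - c j * (q * (q ^ m * x)))) *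
        ∏ j, qPochPair q (q * c j) (q * c j) (q * (q ^ m * x)) =
      (∏ j, (1 - c j / (q ^ m * x))) * ∏ j, qPochPair q (q * c j) (q * c j) (q ^ m * x) := by
    rw [← Finset.prod_mul_distrib, ← Finset.prod_mul_distrib]
    refine Finset.prod_congr rfl fun j _ => ?_
    rw [← qPochPair_eq_one_sub_mul_mul hq, qPochPair_mul_mul hq0,
      ← qPochPair_eq_one_sub_div_mul hq]
  rw [poisedCert, poisedCore, hy, hpow, hxpow, poisedCore]
  calc _ = ((∏ j, (1 - c j * (q * (q ^ m * x)))) *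
        ∏ j, qPochPair q (q * c j) (q * c j) (q * (q ^ m * x))) * ((q * (q ^ m * x))⁻¹ *
        (q ^ (2 * m ^ 2 - m) * ((q ^ m) ^ 4 * q) * (x ^ (4 * m) * x ^ 4))) := by ring
    _ = _ := by
        rw [hprod]
        field_simp

theorem poisedCert_neg (hq : ‖q‖ < 1) (hq0 : q ≠ 0) (c : Fin 4 → ℂ) (m : ℤ) (hx : x ≠ 0) :
    poisedCert q c (-m) x = x ^ 2 * poisedCert q c (m + 1) x⁻¹ := by
  have hqm : q ^ m ≠ 0 := zpow_ne_zero m hq0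
  have hfactor (j : Fin 4) : 1 - c j * (q ^ (-m) * x) = 1 - c j / (q ^ m * x⁻¹) := by
    rw [zpow_neg]
    field_simp
  rw [poisedCert_add_one hq hq0 c m (inv_ne_zero hx), poisedCert, poisedCore_neg hq0 c m x]
  simp only [hfactor]
  generalize ∏ j, (1 - c j / (q ^ m * x⁻¹)) = P
  rw [zpow_neg]
  field_simp

/-! ### Convergence of the bilateral series -/

theorem prod_pow_range_pow_four {t : ℝ} (ht : t ≠ 0) (n : ℕ) :
    (∏ i ∈ Finset.range n, t ^ i) ^ 4 * t ^ n = t ^ (2 * (n : ℤ) ^ 2 - n) := by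
  induction n with
  | zero => simp
  | succ n ih =>
    rw [Finset.prod_range_succ, show (2 * ((n + 1 : ℕ) : ℤ) ^ 2 - (n + 1 : ℕ)) =
      (2 * (n : ℤ) ^ 2 - n) + ((4 * n + 1 : ℕ) : ℤ) by push_cast; ring, zpow_add₀ ht, ← ih,
      zpow_natCast]
    ring

theorem exists_norm_poisedCore_natCast_le (hq : ‖q‖ < 1) (hq0 : q ≠ 0) {C : Fin 4 → ℝ}
    (hC : ∀ j, 0 < C j) {r : ℝ} (hr : 0 < r) (R : ℝ) :
    ∃ M : ℝ, 0 < M ∧ ∀ (n : ℕ) (c : Fin 4 → ℂ) (x : ℂ), (∀ j, ‖c j‖ ≤ C j) →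
      r ≤ ‖x‖ → ‖x‖ ≤ R → ‖poisedCore q c n x‖ ≤ M * (‖q‖ * ∏ j, C j) ^ n := by
  choose M hM h using fun j => exists_norm_qPochPair_pow_mul_le hq hq0 (hC j) hr R
  refine ⟨∏ j, M j, Finset.prod_pos fun j _ => hM j, fun n c x hc hxr hxR => ?_⟩
  have hqpos : 0 < ‖q‖ := norm_pos_iff.2 hq0
  have hxpos : 0 < ‖x‖ := hr.trans_le hxr
  have : 0 < ∏ i ∈ Finset.range n, ‖q‖ ^ i := Finset.prod_pos fun i _ => by positivity
  rw [poisedCore, norm_mul, norm_prod, norm_mul, norm_zpow, norm_zpow,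
    ← prod_pow_range_pow_four hqpos.ne']
  calc _ ≤ (∏ j, (M j * ((C j / ‖x‖) ^ n * (∏ i ∈ Finset.range n, ‖q‖ ^ i)⁻¹))) *
        ((∏ i ∈ Finset.range n, ‖q‖ ^ i) ^ 4 * ‖q‖ ^ n * ‖x‖ ^ (4 * (n : ℤ))) := by
        gcongr with j
        exact h j n (c j) x (hc j) hxr hxR
    _ = _ := by
        rw [Finset.prod_mul_distrib, Finset.prod_mul_distrib, Finset.prod_const, Finset.prod_pow,
          Finset.prod_div_distrib, Finset.prod_const, Finset.card_univ, Fintype.card_fin,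
          show (4 * (n : ℤ)) = ((4 * n : ℕ) : ℤ) by push_cast; ring, zpow_natCast, mul_pow,
          div_pow, pow_mul]
        field_simp

theorem norm_natCast_zpow_mul_le (hq : ‖q‖ < 1) (n : ℕ) (x : ℂ) : ‖q ^ (n : ℤ) * x‖ ≤ ‖x‖ := by
  rw [norm_mul, zpow_natCast, norm_pow]
  exact mul_le_of_le_one_left (norm_nonneg x) (pow_le_one₀ (norm_nonneg q) hq.le)

theorem exists_norm_poisedTerm_natCast_le (hq : ‖q‖ < 1) (hq0 : q ≠ 0) {C : Fin 4 → ℝ}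
    (hC : ∀ j, 0 < C j) {r : ℝ} (hr : 0 < r) (R : ℝ) :
    ∃ M : ℝ, 0 < M ∧ ∀ (n : ℕ) (c : Fin 4 → ℂ) (x : ℂ), (∀ j, ‖c j‖ ≤ C j) →
      r ≤ ‖x‖ → ‖x‖ ≤ R → ‖poisedTerm q c n x‖ ≤ M * (‖q‖ * ∏ j, C j) ^ n := by
  obtain ⟨M, hM, h⟩ := exists_norm_poisedCore_natCast_le hq hq0 hC hr R
  refine ⟨(1 + R ^ 2) * M, by positivity, fun n c x hc hxr hxR => ?_⟩
  rw [poisedTerm, norm_mul, mul_assoc]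
  gcongr
  · refine (norm_sub_le _ _).trans ?_
    rw [norm_one, norm_pow]
    gcongr
    exact (norm_natCast_zpow_mul_le hq n x).trans hxR
  · exact h n c x hc hxr hxR

theorem exists_norm_poisedCert_natCast_le (hq : ‖q‖ < 1) (hq0 : q ≠ 0) {C : Fin 4 → ℝ}
    (hC : ∀ j, 0 < C j) {c : Fin 4 → ℂ} (hc : ∀ j, ‖c j‖ ≤ C j) (hx : x ≠ 0) :
    ∃ M : ℝ, ∀ n : ℕ, ‖poisedCert q c n x‖ ≤ M * (∏ j, C j) ^ n := by
  have : 0 < ‖q‖ := norm_pos_iff.2 hq0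
  have hxpos : 0 < ‖x‖ := norm_pos_iff.2 hx
  obtain ⟨M, hM, h⟩ := exists_norm_poisedCore_natCast_le hq hq0 hC hxpos ‖x‖
  have hP : 0 ≤ ∏ j, (1 + C j * ‖x‖) :=
    Finset.prod_nonneg fun j _ => by have := hC j; positivity
  refine ⟨(∏ j, (1 + C j * ‖x‖)) * (‖x‖⁻¹ * M), fun n => ?_⟩
  have hfactor (j : Fin 4) : ‖1 - c j * (q ^ (n : ℤ) * x)‖ ≤ 1 + C j * ‖x‖ := by
    refine (norm_sub_le _ _).trans ?_
    rw [norm_one, norm_mul]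
    gcongr
    exacts [(hC j).le, hc j, norm_natCast_zpow_mul_le hq n x]
  rw [poisedCert, norm_mul, norm_mul, norm_prod, norm_inv, norm_mul, zpow_natCast, norm_pow]
  calc _ ≤ (∏ j, (1 + C j * ‖x‖)) * (‖q‖ ^ n * ‖x‖)⁻¹ * (M * (‖q‖ * ∏ j, C j) ^ n) := by
        gcongr with j
        · exact_mod_cast hfactor j
        · exact h n c x hc le_rfl le_rfl
    _ = _ := by
        generalize ∏ j, (1 + C j * ‖x‖) = P
        rw [mul_pow]
        field_simp

theorem exists_pos_bound_mul_prod_lt_one {ι : Type*} [Fintype ι] {k : ℝ} {c : ι → ℂ}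
    (h : k * ∏ j, ‖c j‖ < 1) :
    ∃ C : ι → ℝ, (∀ j, 0 < C j) ∧ (∀ j, ‖c j‖ ≤ C j) ∧ k * ∏ j, C j < 1 := by
  have hcont : Continuous fun ε : ℝ => k * ∏ j, (‖c j‖ + ε) := by fun_prop
  obtain ⟨ε, hlt, hε⟩ :=
    (((hcont.tendsto' 0 _ rfl).mono_left nhdsWithin_le_nhds).eventually_lt_const
    (by simpa using h) |>.and (self_mem_nhdsWithin (s := Set.Ioi 0))).exists
  exact ⟨fun j => ‖c j‖ + ε, fun j => add_pos_of_nonneg_of_pos (norm_nonneg _) hε,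
    fun j => le_add_of_nonneg_right hε.le, hlt⟩

theorem exists_summable_norm_poisedTerm_le (hq : ‖q‖ < 1) (hq0 : q ≠ 0) {c₀ : Fin 4 → ℂ}
    (hc₀ : ‖q * ∏ j, c₀ j‖ < 1) {r : ℝ} (hr : 0 < r) (R : ℝ) :
    ∃ u : ℤ → ℝ, Summable u ∧ ∀ (m : ℤ) (c : Fin 4 → ℂ) (x : ℂ), (∀ j, ‖c j‖ ≤ ‖c₀ j‖) →
      r ≤ ‖x‖ → ‖x‖ ≤ R → ‖poisedTerm q c m x‖ ≤ u m := by
  obtain ⟨C, hC, hc₀C, hC1⟩ := exists_pos_bound_mul_prod_lt_one (k := ‖q‖) (c := c₀)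
    (by rwa [← norm_prod, ← norm_mul])
  have hρ : 0 ≤ ‖q‖ * ∏ j, C j :=
    mul_nonneg (norm_nonneg q) (Finset.prod_nonneg fun j _ => (hC j).le)
  obtain ⟨M, hM, h⟩ := exists_norm_poisedTerm_natCast_le hq hq0 hC hr R
  obtain ⟨M', hM', h'⟩ :=
    exists_norm_poisedTerm_natCast_le hq hq0 hC (r := (max R r)⁻¹) (by positivity) r⁻¹
  refine ⟨fun m => (M + R ^ 2 * M') * (‖q‖ * ∏ j, C j) ^ m.natAbs, ?_, fun m c x hc hxr hxR => ?_⟩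
  · refine Summable.mul_left _ (.of_nat_of_neg ?_ ?_) <;>
      simpa using summable_geometric_of_lt_one hρ hC1
  have hcC (j : Fin 4) : ‖c j‖ ≤ C j := (hc j).trans (hc₀C j)
  have hxpos : 0 < ‖x‖ := hr.trans_le hxr
  obtain ⟨n, rfl | rfl⟩ := m.eq_nat_or_neg
  · dsimp only
    rw [Int.natAbs_natCast]
    refine (h n c x hcC hxr hxR).trans ?_
    gcongr
    exact le_add_of_nonneg_right (by positivity)
  · dsimp only
    rw [Int.natAbs_neg, Int.natAbs_natCast, poisedTerm_neg hq0 c _ (norm_pos_iff.1 hxpos), norm_mul,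
      norm_neg, norm_pow, add_mul, mul_assoc]
    refine le_add_of_nonneg_of_le (by positivity) ?_
    gcongr
    refine h' n c x⁻¹ hcC ?_ ?_ <;> rw [norm_inv] <;> gcongr
    exact hxR.trans (le_max_left _ _)

theorem summable_poisedTerm (hq : ‖q‖ < 1) (hq0 : q ≠ 0) {c : Fin 4 → ℂ}
    (hc : ‖q * ∏ j, c j‖ < 1) (hx : x ≠ 0) : Summable fun m => poisedTerm q c m x := by
  obtain ⟨u, hu, h⟩ := exists_summable_norm_poisedTerm_le hq hq0 hc (norm_pos_iff.2 hx) ‖x‖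
  exact .of_norm_bounded hu fun m => h m c x (fun _ => le_rfl) le_rfl le_rfl

theorem summable_poisedCert (hq : ‖q‖ < 1) (hq0 : q ≠ 0) {c : Fin 4 → ℂ}
    (hc : ‖∏ j, c j‖ < 1) (hx : x ≠ 0) : Summable fun m => poisedCert q c m x := by
  obtain ⟨C, hC, hcC, hC1⟩ := exists_pos_bound_mul_prod_lt_one (k := 1) (c := c)
    (by rwa [← norm_prod, one_mul])
  rw [one_mul] at hC1
  have hgeom := summable_geometric_of_lt_one (Finset.prod_nonneg fun j _ => (hC j).le) hC1
  obtain ⟨M, h⟩ := exists_norm_poisedCert_natCast_le hq hq0 hC hcC hx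
  obtain ⟨M', h'⟩ := exists_norm_poisedCert_natCast_le hq hq0 hC hcC (inv_ne_zero hx)
  refine .of_nat_of_neg (.of_norm_bounded (hgeom.mul_left M) h)
    (.of_norm_bounded ((hgeom.mul_left (M' * ∏ j, C j)).mul_left (‖x‖ ^ 2)) fun n => ?_)
  rw [poisedCert_neg hq hq0 c n hx, norm_mul, norm_pow, mul_assoc M', ← pow_succ']
  gcongr
  exact_mod_cast h' (n + 1)

end BilateralSeries

section BilateralSummation

open Filter Topology Function

variable {q x : ℂ}

theorem mul_eq_mul_of_tendsto_of_recurrence {L α β : ℕ → ℂ} {ℓ α' β' : ℂ}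
    (hα : Tendsto (fun n => ∏ i ∈ Finset.range n, α i) atTop (𝓝 α'))
    (hβ : Tendsto (fun n => ∏ i ∈ Finset.range n, β i) atTop (𝓝 β'))
    (hL : Tendsto L atTop (𝓝 ℓ)) (h : ∀ n, α n * L n = β n * L (n + 1)) :
    α' * L 0 = β' * ℓ := by
  have key (n : ℕ) :
      (∏ i ∈ Finset.range n, α i) * L 0 = (∏ i ∈ Finset.range n, β i) * L n := by
    induction n with
    | zero => simp
    | succ n ih =>
      rw [Finset.prod_range_succ, Finset.prod_range_succ]
      linear_combination α n * ih + (∏ i ∈ Finset.range n, β i) * h n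
  refine tendsto_nhds_unique (hα.mul_const (L 0)) ?_
  simp only [key]
  exact hβ.mul hL

theorem tendsto_prod_prod_qPochInf {ι : Type*} [Fintype ι] (hq : ‖q‖ < 1) (u : ι → ℂ) :
    Tendsto (fun n => ∏ i ∈ Finset.range n, ∏ k, (1 - u k * q ^ i)) atTop
      (𝓝 (∏ k, qPochInf (u k) q)) := by
  simp only [Finset.prod_comm (s := Finset.range _)]
  exact tendsto_finsetProd _ fun k _ => tendsto_prod_qPochInf hq (u k)

theorem prod_update_mul {n : ℕ} (c : Fin (n + 1) → ℂ) (i : Fin (n + 1)) (k : ℂ) :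
    ∏ j, update c i (k * c i) j = k * ∏ j, c j := by
  simp [Fin.prod_univ_succAbove _ i, mul_assoc]

theorem poisedCore_update (hq : ‖q‖ < 1) (c : Fin 4 → ℂ) (i : Fin 4) (m : ℤ) (x : ℂ) :
    poisedCore q c m x = (1 - q * c i * (q ^ m * x)) * (1 - q * c i / (q ^ m * x)) *
      poisedCore q (update c i (q * c i)) m x := by
  rw [poisedCore, poisedCore, Fin.prod_univ_succAbove _ i, Fin.prod_univ_succAbove _ i,
    qPochPair_eq_one_sub_mul_mul hq, qPochPair_eq_one_sub_div_mul hq]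
  simp only [update_self, ne_eq, Fin.succAbove_ne, not_false_eq_true, update_of_ne]
  ring

theorem poisedTerm_contiguous (hq : ‖q‖ < 1) (hq0 : q ≠ 0) (hx : x ≠ 0) (c : Fin 4 → ℂ) (i : Fin 4)
    (m : ℤ) :
    (1 - q * ∏ j, c j) * poisedTerm q c m x =
      (∏ k, (1 - q * (c i * c (i.succAbove k)))) * poisedTerm q (update c i (q * c i)) m x +
      q * c i * (poisedCert q (update c i (q * c i)) (m + 1) x -
        poisedCert q (update c i (q * c i)) m x) := by
  have hy : q ^ m * x ≠ 0 := mul_ne_zero (zpow_ne_zero m hq0) hx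
  rw [poisedCert_add_one hq hq0 _ m hx, poisedCert, poisedTerm, poisedTerm,
    poisedCore_update hq c i]
  simp only [Fin.prod_univ_succAbove _ i, update_self, ne_eq, Fin.succAbove_ne, not_false_eq_true,
    update_of_ne, Fin.prod_univ_three]
  generalize poisedCore q (update c i (q * c i)) m x = K
  generalize q ^ m * x = y at hy
  field_simp
  ring

theorem tsum_poisedTerm_contiguous (hq : ‖q‖ < 1) (hq0 : q ≠ 0) (hx : x ≠ 0) {c : Fin 4 → ℂ}
    (hc : ‖q * ∏ j, c j‖ < 1) (i : Fin 4) :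
    (1 - q * ∏ j, c j) * ∑' m, poisedTerm q c m x =
      (∏ k, (1 - q * (c i * c (i.succAbove k)))) *
        ∑' m, poisedTerm q (update c i (q * c i)) m x := by
  set c' := update c i (q * c i)
  have hprod : ∏ j, c' j = q * ∏ j, c j := prod_update_mul c i q
  have hterm' : Summable fun m => poisedTerm q c' m x := by
    refine summable_poisedTerm hq hq0 ?_ hx
    rw [hprod, norm_mul]
    exact mul_lt_one_of_nonneg_of_lt_one_left (norm_nonneg q) hq hc.le
  have hcert : Summable fun m => poisedCert q c' m x :=
    summable_poisedCert hq hq0 (by rwa [hprod]) hx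
  have hcert' : Summable fun m : ℤ => poisedCert q c' (m + 1) x :=
    ((Equiv.addRight (1 : ℤ)).summable_iff).2 hcert
  have hshift : ∑' m : ℤ, poisedCert q c' (m + 1) x = ∑' m, poisedCert q c' m x :=
    (Equiv.addRight (1 : ℤ)).tsum_eq fun m => poisedCert q c' m x
  rw [← tsum_mul_left, ← tsum_mul_left, tsum_congr fun m => poisedTerm_contiguous hq hq0 hx c i m,
    (hterm'.mul_left _).tsum_add ((hcert'.sub hcert).mul_left _), tsum_mul_left (a := q * c i),
    hcert'.tsum_sub hcert, hshift, sub_self, mul_zero, add_zero]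

theorem continuous_poisedTerm (hq : ‖q‖ < 1) (m : ℤ) (x : ℂ) :
    Continuous fun c => poisedTerm q c m x := by
  simp only [poisedTerm, poisedCore, qPochPair]
  have := continuous_qPochInf hq
  fun_prop

theorem tendsto_update_pow_mul {n : ℕ} (hq : ‖q‖ < 1) (c : Fin n → ℂ) (i : Fin n) :
    Tendsto (fun n => update c i (q ^ n * c i)) atTop (𝓝 (update c i 0)) :=
  tendsto_const_nhds.update i <| by
    simpa using (tendsto_pow_atTop_nhds_zero_of_norm_lt_one hq).mul_const (c i)

theorem norm_update_pow_mul_le {n : ℕ} (hq : ‖q‖ < 1) (c : Fin n → ℂ) (i : Fin n) (k : ℕ)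
    (j : Fin n) : ‖update c i (q ^ k * c i) j‖ ≤ ‖c j‖ := by
  obtain rfl | hj := eq_or_ne j i
  · rw [update_self, norm_mul, norm_pow]
    exact mul_le_of_le_one_left (norm_nonneg _) (pow_le_one₀ (norm_nonneg q) hq.le)
  · rw [update_of_ne hj]

theorem tsum_poisedTerm_update_zero (hq : ‖q‖ < 1) (hq0 : q ≠ 0) (hx : x ≠ 0) {c : Fin 4 → ℂ}
    (hc : ‖q * ∏ j, c j‖ < 1) (i : Fin 4) :
    qPochInf (q * ∏ j, c j) q * ∑' m, poisedTerm q c m x =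
      (∏ k, qPochInf (q * (c i * c (i.succAbove k))) q) *
        ∑' m, poisedTerm q (update c i 0) m x := by
  obtain ⟨u, hu, hle⟩ := exists_summable_norm_poisedTerm_le hq hq0 hc (norm_pos_iff.2 hx) ‖x‖
  have hlim : Tendsto (fun n : ℕ => ∑' m, poisedTerm q (update c i (q ^ n * c i)) m x) atTop
      (𝓝 (∑' m, poisedTerm q (update c i 0) m x)) :=
    tendsto_tsum_of_dominated_convergence hu
      (fun m => ((continuous_poisedTerm hq m x).tendsto _).comp (tendsto_update_pow_mul hq c i))
      (.of_forall fun n m => hle m _ x (norm_update_pow_mul_le hq c i n) le_rfl le_rfl)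
  have hstep (n : ℕ) : (1 - q * (∏ j, c j) * q ^ n) *
        ∑' m, poisedTerm q (update c i (q ^ n * c i)) m x =
      (∏ k, (1 - q * (c i * c (i.succAbove k)) * q ^ n)) *
        ∑' m, poisedTerm q (update c i (q ^ (n + 1) * c i)) m x := by
    have hcn : ‖q * ∏ j, update c i (q ^ n * c i) j‖ < 1 := by
      rw [prod_update_mul, mul_left_comm, norm_mul, norm_pow]
      exact mul_lt_one_of_nonneg_of_lt_one_right (pow_le_one₀ (norm_nonneg q) hq.le)
        (norm_nonneg _) hc
    have h := tsum_poisedTerm_contiguous hq hq0 hx hcn i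
    simp only [prod_update_mul, update_self, update_idem, ne_eq, Fin.succAbove_ne,
      not_false_eq_true, update_of_ne] at h
    convert h using 3 <;> ring_nf
  simpa using mul_eq_mul_of_tendsto_of_recurrence (tendsto_prod_qPochInf hq (q * ∏ j, c j))
    (tendsto_prod_prod_qPochInf hq fun k => q * (c i * c (i.succAbove k))) hlim hstep

theorem tsum_poisedTerm_eq (hq : ‖q‖ < 1) (hq0 : q ≠ 0) (hx : x ≠ 0) {c : Fin 4 → ℂ}
    (hc : ‖q * ∏ j, c j‖ < 1) :
    qPochInf (q * ∏ j, c j) q * ∑' m, poisedTerm q c m x =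
      (∏ j, ∏ k ∈ Finset.Ioi j, qPochInf (q * (c j * c k)) q) * ∑' m, poisedTerm q 0 m x := by
  have hzero (i : Fin 4) {c : Fin 4 → ℂ} (h : c i = 0) : ∏ j, c j = 0 :=
    Finset.prod_eq_zero (Finset.mem_univ i) h
  have step (i i' : Fin 4) {c : Fin 4 → ℂ} (h : c i' = 0) :=
    tsum_poisedTerm_update_zero hq hq0 hx (c := c) (by simp [hzero i' h]) i
  have h₁ := step 1 0 (c := update c 0 0) rfl
  have h₂ := step 2 0 (c := update (update c 0 0) 1 0) rfl
  have h₃ := step 3 0 (c := update (update (update c 0 0) 1 0) 2 0) rfl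
  have hall : update (update (update (update c 0 0) 1 0) 2 0) 3 0 = 0 := by
    ext j
    fin_cases j <;> rfl
  rw [hzero 0 rfl, mul_zero, qPochInf_zero, one_mul] at h₁ h₂ h₃
  rw [tsum_poisedTerm_update_zero hq hq0 hx hc 0, h₁, h₂, h₃, hall]
  simp [Fin.prod_univ_succ, update, Fin.succAbove, mul_assoc]

end BilateralSummation

section Theta

variable {q x z : ℂ}

theorem poisedTerm_zero (q : ℂ) (m : ℤ) (x : ℂ) :
    poisedTerm q 0 m x = (1 - (q ^ m * x) ^ 2) * (q ^ (2 * m ^ 2 - m) * x ^ (4 * m)) := by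
  simp [poisedTerm, poisedCore, qPochPair]

theorem poisedTerm_zero_mul (hq0 : q ≠ 0) (m : ℤ) (hx : x ≠ 0) :
    poisedTerm q 0 m (q * x) = q⁻¹ * (x ^ 4)⁻¹ * poisedTerm q 0 (m + 1) x := by
  have hy : q ^ (m + 1) * x = q ^ m * (q * x) := by
    rw [zpow_add_one₀ hq0]
    ring
  have hqpow : q ^ (2 * (m + 1) ^ 2 - (m + 1)) = q ^ (2 * m ^ 2 - m) * (q ^ (4 * m) * q) := by
    rw [← zpow_add_one₀ hq0, ← zpow_add₀ hq0]
    congr 1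
    ring
  have hxpow : x ^ (4 * (m + 1)) = x ^ (4 * m) * x ^ 4 := by
    rw [mul_add, mul_one, zpow_add₀ hx]
    rfl
  rw [poisedTerm_zero, poisedTerm_zero, hy, hqpow, hxpow, mul_zpow]
  field_simp

theorem differentiableAt_qPochPair (hq : ‖q‖ < 1) (b c : ℂ) (hz : z ≠ 0) :
    DifferentiableAt ℂ (qPochPair q b c) z :=
  ((differentiable_qPochInf hq _).fun_comp' z (by fun_prop)).fun_mul
    ((differentiable_qPochInf hq _).fun_comp' z (by fun_prop (disch := assumption)))

theorem differentiableAt_poisedTerm (hq : ‖q‖ < 1) (hq0 : q ≠ 0) (c : Fin 4 → ℂ) (m : ℤ)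
    (hx : x ≠ 0) : DifferentiableAt ℂ (poisedTerm q c m) x := by
  have hpair (j : Fin 4) :
      DifferentiableAt ℂ (fun x => qPochPair q (q * c j) (q * c j) (q ^ m * x)) x :=
    (differentiableAt_qPochPair hq _ _ (mul_ne_zero (zpow_ne_zero m hq0) hx)).fun_comp' x
      (by fun_prop)
  have hpow : DifferentiableAt ℂ (fun x : ℂ => x ^ (4 * m)) x := differentiableAt_zpow.2 (.inl hx)
  exact .fun_mul (by fun_prop)
    (.fun_mul (.fun_finsetProd fun j _ => hpair j) (hpow.const_mul _))

theorem differentiableAt_poisedTerm_inv (hq : ‖q‖ < 1) (hq0 : q ≠ 0) (c : Fin 4 → ℂ) (m : ℤ)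
    (hz : z ≠ 0) : DifferentiableAt ℂ (fun z => poisedTerm q c m z⁻¹) z :=
  (differentiableAt_poisedTerm hq hq0 c m (inv_ne_zero hz)).fun_comp' z (differentiableAt_inv hz)

/-- The theta function `∑ (-1) ^ n q ^ (n (n - 1) / 2) z ^ (-2 n)`, summed over pairs of terms: the
part of the bilateral series which does not depend on its parameters. -/
noncomputable def poisedTheta (q z : ℂ) : ℂ := ∑' m, poisedTerm q 0 m z⁻¹

theorem differentiableAt_poisedTheta (hq : ‖q‖ < 1) (hq0 : q ≠ 0) (hz : z ≠ 0) :
    DifferentiableAt ℂ (poisedTheta q) z := by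
  have hpos : 0 < ‖z‖ := norm_pos_iff.2 hz
  obtain ⟨u, hu, h⟩ := exists_summable_norm_poisedTerm_le hq hq0 (c₀ := 0) (by simp)
    (r := (2 * ‖z‖)⁻¹) (by positivity) (‖z‖ / 2)⁻¹
  have hopen : IsOpen {y : ℂ | ‖z‖ / 2 < ‖y‖ ∧ ‖y‖ < 2 * ‖z‖} :=
    (isOpen_lt continuous_const continuous_norm).inter (isOpen_lt continuous_norm continuous_const)
  have hterm (m : ℤ) : DifferentiableOn ℂ (fun y => poisedTerm q 0 m y⁻¹)
      {y : ℂ | ‖z‖ / 2 < ‖y‖ ∧ ‖y‖ < 2 * ‖z‖} := fun y hy =>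
    (differentiableAt_poisedTerm_inv hq hq0 0 m
      (norm_pos_iff.1 ((half_pos hpos).trans hy.1))).differentiableWithinAt
  refine (Complex.differentiableOn_tsum_of_summable_norm hu hterm hopen fun m y hy =>
    h m 0 y⁻¹ (fun _ => le_rfl) ?_ ?_).differentiableAt
      (hopen.mem_nhds ⟨half_lt_self hpos, by linarith⟩)
  all_goals
    have : 0 < ‖y‖ := (half_pos hpos).trans hy.1
    rw [norm_inv]
    gcongr
  exacts [hy.2.le, hy.1.le]

theorem poisedTheta_mul (hq0 : q ≠ 0) (hz : z ≠ 0) :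
    poisedTheta q (q * z) = (q ^ 3 * z ^ 4)⁻¹ * poisedTheta q z := by
  have hterm (m : ℤ) : poisedTerm q 0 (m + 1) (q * z)⁻¹ =
      (q ^ 3 * z ^ 4)⁻¹ * poisedTerm q 0 m z⁻¹ := by
    have h := poisedTerm_zero_mul hq0 m (inv_ne_zero (mul_ne_zero hq0 hz))
    rw [show q * (q * z)⁻¹ = z⁻¹ by field_simp] at h
    rw [h]
    field_simp
  rw [poisedTheta, poisedTheta, ← tsum_mul_left, ← tsum_congr hterm]
  exact ((Equiv.addRight (1 : ℤ)).tsum_eq fun m => poisedTerm q 0 m (q * z)⁻¹).symm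

end Theta

section AskeyWilson

open Function Set

variable {ι : Type*} {q : ℂ} {z : ℂ} {p : ℂ} {γ : Path p p}

section Contours

variable {b b' c : ι → ℂ} {S S' T T' : Set ℂ}

theorem IsSeparatingContour.mono (h : IsSeparatingContour γ S T) (hS : S' ⊆ S) (hT : T' ⊆ T) :
    IsSeparatingContour γ S' T' where
  piecewiseC1 := h.piecewiseC1
  avoids_inside t ht := h.avoids_inside t (hS ht)
  avoids_outside t ht := h.avoids_outside t (hT ht)
  winding_inside w hw := h.winding_inside w (hS hw)
  winding_outside w hw := h.winding_outside w (hT hw)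

theorem innerPoles_subset (h : ∀ j, b' j = 0 ∨ ∃ n : ℕ, b' j = q ^ n * b j) :
    innerPoles q b' ⊆ innerPoles q b := by
  rintro z (rfl | ⟨j, k, rfl⟩)
  · exact zero_mem_innerPoles q b
  · obtain h | ⟨n, h⟩ := h j
    · exact .inl (by rw [h, zero_mul])
    · exact .inr ⟨j, n + k, by rw [h, pow_add]; ring⟩

theorem outerPoles_subset (h : ∀ j, b' j = 0 ∨ ∃ n : ℕ, b' j = q ^ n * b j) :
    outerPoles q b' ⊆ outerPoles q b := by
  rintro z ⟨j, k, hz⟩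
  obtain h | ⟨n, h⟩ := h j
  · simp [h] at hz
  · exact ⟨j, n + k, by rw [← hz, h, pow_add]; ring⟩

theorem IsSeparatingContour.update [DecidableEq ι]
    (hγ : IsSeparatingContour γ (innerPoles q b) (outerPoles q b)) (i : ι) {w : ℂ}
    (hw : w = 0 ∨ ∃ n : ℕ, w = q ^ n * b i) :
    IsSeparatingContour γ (innerPoles q (update b i w)) (outerPoles q (update b i w)) := by
  have h (j : ι) : Function.update b i w j = 0 ∨
      ∃ n : ℕ, Function.update b i w j = q ^ n * b j := by
    obtain rfl | hj := eq_or_ne j i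
    · rwa [update_self]
    · exact .inr ⟨0, by rw [update_of_ne hj, pow_zero, one_mul]⟩
  exact hγ.mono (innerPoles_subset h) (outerPoles_subset h)

theorem IsSeparatingContour.ne_zero_of_mem_range (hγ : IsSeparatingContour γ (innerPoles q c) T)
    (hz : z ∈ range γ) : z ≠ 0 := by
  rintro rfl
  obtain ⟨t, ht⟩ := hz
  exact hγ.avoids_inside t (ht ▸ zero_mem_innerPoles q c)

theorem IsSeparatingContour.qPochPair_ne_zero (hq : ‖q‖ < 1)
    (hγ : IsSeparatingContour γ (innerPoles q c) (outerPoles q b)) (hz : z ∈ range γ) (j : ι) :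
    qPochPair q (b j) (c j) z ≠ 0 := by
  obtain ⟨t, rfl⟩ := hz
  exact _root_.qPochPair_ne_zero hq (hγ.avoids_inside t) (hγ.avoids_outside t) j

theorem IsSeparatingContour.continuousOn_div_prod_qPochPair [Fintype ι] (hq : ‖q‖ < 1)
    (hγ : IsSeparatingContour γ (innerPoles q c) (outerPoles q b)) {N : ℂ → ℂ}
    (hN : ∀ z ≠ 0, DifferentiableAt ℂ N z) :
    ContinuousOn (fun z => N z / ∏ j, qPochPair q (b j) (c j) z) (range γ) := fun z hz =>
  have hz0 := hγ.ne_zero_of_mem_range hz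
  ((hN z hz0).fun_div
    (.fun_finsetProd fun j _ => differentiableAt_qPochPair hq (b j) (c j) hz0)
    (Finset.prod_ne_zero_iff.2 fun j _ =>
      hγ.qPochPair_ne_zero hq hz j)).continuousAt.continuousWithinAt

end Contours

/-- The integrand `(1 - z²) F(z) / (z ∏ (b_j z, b_j / z; q)_∞)`, which is the Askey–Wilson integrand
for `F = poisedTheta q` and the `m`-th term of the series for `F z = poisedTerm q c m z⁻¹`. -/
noncomputable def awIntegrand [Fintype ι] (q : ℂ) (b : ι → ℂ) (F : ℂ → ℂ) (z : ℂ) : ℂ :=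
  (1 - z ^ 2) / z * F z / ∏ j, qPochPair q (b j) (b j) z

theorem differentiableAt_awNumerator {F : ℂ → ℂ} (hF : ∀ z ≠ 0, DifferentiableAt ℂ F z)
    (hz : z ≠ 0) :
    DifferentiableAt ℂ (fun z => (1 - z ^ 2) / z * F z) z := by
  have := hF z hz
  fun_prop (disch := assumption)

theorem continuousOn_awIntegrand [Fintype ι] {b : ι → ℂ} (hq : ‖q‖ < 1)
    (hγ : IsSeparatingContour γ (innerPoles q b) (outerPoles q b)) {F : ℂ → ℂ}
    (hF : ∀ z ≠ 0, DifferentiableAt ℂ F z) : ContinuousOn (awIntegrand q b F) (range γ) :=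
  hγ.continuousOn_div_prod_qPochPair hq fun _ hz => differentiableAt_awNumerator hF hz

theorem hasSum_lineIntegral_awIntegrand [Fintype ι] {b : ι → ℂ} (hq : ‖q‖ < 1) (hq0 : q ≠ 0)
    (hγ : IsSeparatingContour γ (innerPoles q b) (outerPoles q b)) {c : Fin 4 → ℂ}
    (hc : ‖q * ∏ j, c j‖ < 1) :
    HasSum (fun m => lineIntegral (awIntegrand q b fun z => poisedTerm q c m z⁻¹) γ)
      (lineIntegral (awIntegrand q b fun z => ∑' m, poisedTerm q c m z⁻¹) γ) := by
  obtain ⟨r, R, hr, hsub⟩ :=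
    exists_range_subset_annulus γ fun h => hγ.ne_zero_of_mem_range h rfl
  have hlt (z : ℂ) (hz : z ∈ range γ) : r < ‖z‖ ∧ ‖z‖ < R :=
    ⟨not_le.1 fun h => (hsub hz).2 (mem_closedBall_zero_iff.2 h), mem_ball_zero_iff.1 (hsub hz).1⟩
  have hR : 0 < R := hr.trans ((hlt p γ.source_mem_range).1.trans (hlt p γ.source_mem_range).2)
  obtain ⟨u, hu, hle⟩ := exists_summable_norm_poisedTerm_le hq hq0 hc (inv_pos.2 hR) r⁻¹
  obtain ⟨M, hM⟩ := (isCompact_range γ.continuous).exists_bound_of_continuousOn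
    (continuousOn_awIntegrand hq hγ (F := 1) fun z _ => by fun_prop)
  have hfactor (F : ℂ → ℂ) (z : ℂ) : awIntegrand q b F z = awIntegrand q b 1 z * F z := by
    rw [awIntegrand, awIntegrand, Pi.one_apply]
    ring
  convert hasSum_lineIntegral hγ.piecewiseC1 (hu.mul_left M) (fun m =>
    continuousOn_awIntegrand hq hγ fun z hz => differentiableAt_poisedTerm_inv hq hq0 c m hz)
    fun m z hz => ?_ using 2
  · ext z
    rw [hfactor, ← tsum_mul_left]
    exact tsum_congr fun m => (hfactor (fun z => poisedTerm q c m z⁻¹) z).symm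
  · rw [hfactor, norm_mul]
    have := hr.trans (hlt z hz).1
    refine mul_le_mul (hM z hz) (hle m c z⁻¹ (fun _ => le_rfl) ?_ ?_) (norm_nonneg _)
      ((norm_nonneg _).trans (hM z hz)) <;> rw [norm_inv] <;> gcongr
    exacts [(hlt z hz).2.le, (hlt z hz).1.le]

theorem IsSeparatingContour.lineIntegral_zpow {c : ι → ℂ} {T : Set ℂ}
    (hγ : IsSeparatingContour γ (innerPoles q c) T) (n : ℤ) :
    lineIntegral (fun z => z ^ n) γ = if n = -1 then 2 * Real.pi * Complex.I else 0 := by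
  split_ifs with hn
  · simpa [hn, hγ.winding_inside 0 (zero_mem_innerPoles q c)] using lineIntegral_sub_inv γ 0
  · simpa using
      lineIntegral_zpow_eq_zero hγ.piecewiseC1 (fun h => hγ.ne_zero_of_mem_range h rfl) hn

theorem awIntegrand_poisedTerm_zero (m : ℤ) (hz : z ≠ 0) :
    awIntegrand q (0 : Fin 4 → ℂ) (fun z => poisedTerm q 0 m z⁻¹) z =
      q ^ (2 * m ^ 2 - m) * ((1 + (q ^ m) ^ 2) * z ^ (-4 * m - 1) -
        (z ^ (-4 * m + 1) + (q ^ m) ^ 2 * z ^ (-4 * m - 3))) := by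
  have h₃ : z ^ (-4 * m - 3) = z ^ (-4 * m) / z ^ 3 := zpow_sub₀ hz _ _
  rw [awIntegrand, poisedTerm_zero, zpow_sub_one₀ hz, zpow_add_one₀ hz, h₃, inv_zpow', ← neg_mul]
  simp only [Pi.zero_apply, qPochPair, zero_mul, zero_div, qPochInf_zero, one_mul,
    Finset.prod_const_one, div_one]
  field_simp
  ring

theorem lineIntegral_awIntegrand_poisedTerm_zero {T : Set ℂ}
    (hγ : IsSeparatingContour γ (innerPoles q (0 : Fin 4 → ℂ)) T) (m : ℤ) :
    lineIntegral (awIntegrand q (0 : Fin 4 → ℂ) fun z => poisedTerm q 0 m z⁻¹) γ =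
      if m = 0 then 2 * (2 * Real.pi * Complex.I) else 0 := by
  have hpow (k : ℂ) (n : ℤ) : ContinuousOn (fun z : ℂ => k * z ^ n) (range γ) := fun z hz =>
    ((continuousAt_zpow₀ z n (.inl (hγ.ne_zero_of_mem_range hz))).const_mul k).continuousWithinAt
  have hpow' (n : ℤ) : ContinuousOn (fun z : ℂ => z ^ n) (range γ) := by simpa using hpow 1 n
  rw [lineIntegral_congr fun z hz => awIntegrand_poisedTerm_zero m (hγ.ne_zero_of_mem_range hz),
    lineIntegral_const_mul,
    lineIntegral_sub hγ.piecewiseC1 (hpow _ _) ((hpow' _).fun_add (hpow _ _)),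
    lineIntegral_add hγ.piecewiseC1 (hpow' _) (hpow _ _), lineIntegral_const_mul,
    lineIntegral_const_mul, hγ.lineIntegral_zpow, hγ.lineIntegral_zpow, hγ.lineIntegral_zpow,
    if_neg (by lia : ¬-4 * m + 1 = -1), if_neg (by lia : ¬-4 * m - 3 = -1)]
  obtain rfl | hm := eq_or_ne m 0
  · norm_num
  · simp [hm]

theorem lineIntegral_awIntegrand_zero (hq : ‖q‖ < 1) (hq0 : q ≠ 0)
    (hγ : IsSeparatingContour γ (innerPoles q (0 : Fin 4 → ℂ)) (outerPoles q (0 : Fin 4 → ℂ))) :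
    lineIntegral (awIntegrand q (0 : Fin 4 → ℂ) (poisedTheta q)) γ =
      2 * (2 * Real.pi * Complex.I) := by
  have h := hasSum_lineIntegral_awIntegrand hq hq0 hγ (c := 0) (by simp)
  simp only [lineIntegral_awIntegrand_poisedTerm_zero hγ] at h
  exact h.unique (hasSum_ite_eq 0 _)

end AskeyWilson

section AskeyWilsonEvaluation

open Filter Topology Function Set

variable {q z p : ℂ} {γ : Path p p} {b : Fin 4 → ℂ}

theorem qPochPair_eq_prod_mul (hq : ‖q‖ < 1) (b z : ℂ) (n : ℕ) :
    qPochPair q b b z =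
      (∏ l ∈ Finset.range n, (1 - b * z * q ^ l)) * (∏ l ∈ Finset.range n, (1 - b / z * q ^ l)) *
        qPochPair q (q ^ n * b) (q ^ n * b) z := by
  rw [qPochPair, qPochPair, qPochInf_eq_prod_mul hq (b * z) n, qPochInf_eq_prod_mul hq (b / z) n,
    show q ^ n * b * z = b * z * q ^ n by ring, show q ^ n * b / z = b / z * q ^ n by ring]
  ring

theorem awIntegrand_update_pow_mul (hq : ‖q‖ < 1) (F : ℂ → ℂ) (i : Fin 4)
    (h : qPochPair q (b i) (b i) z ≠ 0) (n : ℕ) :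
    awIntegrand q (update b i (q ^ n * b i)) F z =
      (∏ l ∈ Finset.range n, (1 - b i * z * q ^ l)) *
        (∏ l ∈ Finset.range n, (1 - b i / z * q ^ l)) * awIntegrand q b F z := by
  rw [qPochPair_eq_prod_mul hq _ z n] at h
  rw [awIntegrand, awIntegrand, Fin.prod_univ_succAbove _ i, Fin.prod_univ_succAbove _ i,
    qPochPair_eq_prod_mul hq (b i) z n, mul_assoc (_ * _), ← mul_div_assoc,
    mul_div_mul_left _ _ (left_ne_zero_of_mul h)]
  simp only [update_self, ne_eq, Fin.succAbove_ne, not_false_eq_true, update_of_ne]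

/-- The certificate of the contiguous relation for the Askey–Wilson integrand: the error term of
that relation is the `q`-difference of `awCert`. -/
noncomputable def awCert (q : ℂ) (b : Fin 4 → ℂ) (z : ℂ) : ℂ :=
  z ^ 2 * poisedTheta q z / ∏ j, qPochPair q (b j) (q * b j) z

theorem awCert_eq (hq : ‖q‖ < 1) (h : ∀ j, qPochPair q (b j) (b j) z ≠ 0) :
    awCert q b z =
      z ^ 2 * poisedTheta q z * (∏ j, (1 - b j / z)) / ∏ j, qPochPair q (b j) (b j) z := by
  simp only [qPochPair_eq_one_sub_div_mul hq _ (b _)] at h ⊢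
  rw [awCert, Finset.prod_mul_distrib, mul_comm (∏ j, (1 - b j / z)),
    mul_div_mul_right _ _ (Finset.prod_ne_zero_iff.2 fun j _ => left_ne_zero_of_mul (h j))]

theorem mul_awCert_mul (hq : ‖q‖ < 1) (hq0 : q ≠ 0) (hz : z ≠ 0)
    (h : ∀ j, qPochPair q (b j) (b j) z ≠ 0) :
    q * awCert q b (q * z) =
      (z ^ 2)⁻¹ * poisedTheta q z * (∏ j, (1 - b j * z)) / ∏ j, qPochPair q (b j) (b j) z := by
  simp only [qPochPair_eq_one_sub_mul_mul hq (b _)] at h ⊢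
  simp only [awCert, qPochPair_mul_mul hq0, poisedTheta_mul hq0 hz]
  rw [Finset.prod_mul_distrib, mul_comm (∏ j, (1 - b j * z)),
    mul_div_mul_right _ _ (Finset.prod_ne_zero_iff.2 fun j _ => left_ne_zero_of_mul (h j))]
  field_simp

theorem awIntegrand_contiguous (hq : ‖q‖ < 1) (hq0 : q ≠ 0) (hz : z ≠ 0)
    (h : ∀ j, qPochPair q (b j) (b j) z ≠ 0) (i : Fin 4) :
    (1 - ∏ j, b j) * awIntegrand q (update b i (q * b i)) (poisedTheta q) z =
      (∏ k, (1 - b i * b (i.succAbove k))) * awIntegrand q b (poisedTheta q) z +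
      b i * (awCert q b z - q * awCert q b (q * z)) := by
  have hupd := awIntegrand_update_pow_mul hq (poisedTheta q) i (h i) 1
  simp only [pow_one, Finset.prod_range_one, pow_zero, mul_one] at hupd
  rw [hupd, awCert_eq hq h, mul_awCert_mul hq hq0 hz h, awIntegrand]
  have hprod := Finset.prod_ne_zero_iff.2 fun j (_ : j ∈ Finset.univ) => h j
  generalize ∏ j, qPochPair q (b j) (b j) z = P at hprod
  simp only [Fin.prod_univ_succAbove _ i, Fin.prod_univ_three]
  field_simp
  ring

theorem differentiableAt_sq_mul_poisedTheta (hq : ‖q‖ < 1) (hq0 : q ≠ 0) (hz : z ≠ 0) :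
    DifferentiableAt ℂ (fun z => z ^ 2 * poisedTheta q z) z :=
  (differentiableAt_id.fun_pow 2).fun_mul (differentiableAt_poisedTheta hq hq0 hz)

theorem IsSeparatingContour.of_mul (hγ : IsSeparatingContour γ (innerPoles q b) (outerPoles q b)) :
    IsSeparatingContour γ (innerPoles q fun j => q * b j) (outerPoles q b) :=
  hγ.mono (innerPoles_subset fun _ => .inr ⟨1, by rw [pow_one]⟩) subset_rfl

theorem IsSeparatingContour.scalePath_mul (hq0 : q ≠ 0)
    (hγ : IsSeparatingContour γ (innerPoles q b) (outerPoles q b)) :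
    IsSeparatingContour (scalePath q γ) (innerPoles q fun j => q * b j) (outerPoles q b) := by
  have h : IsSeparatingContour γ (innerPoles q b) (outerPoles q fun j => q * b j) :=
    hγ.mono subset_rfl (outerPoles_subset fun _ => .inr ⟨1, by rw [pow_one]⟩)
  refine h.scale hq0 (fun z => ?_) fun z => ?_
  · simp [innerPoles, hq0, mul_assoc]
  · simp [outerPoles, mul_assoc, mul_left_comm q]

theorem lineIntegral_mul_awCert_mul (hq : ‖q‖ < 1) (hq0 : q ≠ 0)
    (hγ : IsSeparatingContour γ (innerPoles q b) (outerPoles q b)) :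
    lineIntegral (fun z => q * awCert q b (q * z)) γ = lineIntegral (awCert q b) γ := by
  rw [← lineIntegral_scalePath]
  exact lineIntegral_eq_of_isSeparatingContour hq (hγ.scalePath_mul hq0) hγ.of_mul
    fun _ => differentiableAt_sq_mul_poisedTheta hq hq0

theorem lineIntegral_awIntegrand_contiguous (hq : ‖q‖ < 1) (hq0 : q ≠ 0)
    (hγ : IsSeparatingContour γ (innerPoles q b) (outerPoles q b)) (i : Fin 4) :
    (1 - ∏ j, b j) * lineIntegral (awIntegrand q (update b i (q * b i)) (poisedTheta q)) γ =
      (∏ k, (1 - b i * b (i.succAbove k))) * lineIntegral (awIntegrand q b (poisedTheta q)) γ := by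
  have hθ (z : ℂ) (hz : z ≠ 0) : DifferentiableAt ℂ (poisedTheta q) z :=
    differentiableAt_poisedTheta hq hq0 hz
  have hcert : ContinuousOn (awCert q b) (range γ) :=
    hγ.of_mul.continuousOn_div_prod_qPochPair hq fun _ => differentiableAt_sq_mul_poisedTheta hq hq0
  have hcert' : ContinuousOn (fun z => q * awCert q b (q * z)) (range γ) := by
    have h := (hγ.scalePath_mul hq0).continuousOn_div_prod_qPochPair hq fun _ =>
      differentiableAt_sq_mul_poisedTheta hq hq0
    refine continuousOn_const.mul (h.comp (by fun_prop) ?_)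
    rintro _ ⟨t, rfl⟩
    exact ⟨t, rfl⟩
  rw [← lineIntegral_const_mul, ← lineIntegral_const_mul, lineIntegral_congr fun z hz =>
      awIntegrand_contiguous hq hq0 (hγ.ne_zero_of_mem_range hz) (hγ.qPochPair_ne_zero hq hz) i,
    lineIntegral_add hγ.piecewiseC1
      (continuousOn_const.fun_mul (continuousOn_awIntegrand hq hγ hθ))
      (continuousOn_const.fun_mul (hcert.fun_sub hcert')),
    lineIntegral_const_mul (b i), lineIntegral_sub hγ.piecewiseC1 hcert hcert',
    lineIntegral_mul_awCert_mul hq hq0 hγ, sub_self, mul_zero, add_zero]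

theorem norm_prod_one_sub_mul_pow_le (hq : ‖q‖ < 1) (w : ℂ) (n : ℕ) :
    ‖∏ l ∈ Finset.range n, (1 - w * q ^ l)‖ ≤ Real.exp (‖w‖ * (1 - ‖q‖)⁻¹) := by
  refine le_trans ?_ (prod_one_add_mul_pow_le (norm_nonneg q) hq (norm_nonneg w) n)
  rw [norm_prod]
  refine Finset.prod_le_prod (fun _ _ => norm_nonneg _) fun l _ => (norm_sub_le _ _).trans ?_
  rw [norm_one, norm_mul, norm_pow]

theorem tendsto_awIntegrand_update (hq : ‖q‖ < 1) (F : ℂ → ℂ) (i : Fin 4)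
    (h : ∀ j, qPochPair q (update b i 0 j) (update b i 0 j) z ≠ 0) :
    Tendsto (fun n => awIntegrand q (update b i (q ^ n * b i)) F z) atTop
      (𝓝 (awIntegrand q (update b i 0) F z)) := by
  have hcont : Continuous fun b : Fin 4 → ℂ => ∏ j, qPochPair q (b j) (b j) z := by
    simp only [qPochPair]
    have := continuous_qPochInf hq
    fun_prop
  exact tendsto_const_nhds.div ((hcont.tendsto _).comp (tendsto_update_pow_mul hq b i))
    (Finset.prod_ne_zero_iff.2 fun j _ => h j)

theorem exists_norm_awIntegrand_update_le (hq : ‖q‖ < 1)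
    (hγ : IsSeparatingContour γ (innerPoles q b) (outerPoles q b)) {F : ℂ → ℂ}
    (hF : ∀ z ≠ 0, DifferentiableAt ℂ F z) (i : Fin 4) :
    ∃ C : ℝ, ∀ n : ℕ, ∀ z ∈ range γ, ‖awIntegrand q (update b i (q ^ n * b i)) F z‖ ≤ C := by
  have hinv : ContinuousOn (fun z => b i / z) (range γ) :=
    continuousOn_const.div continuousOn_id fun z hz => hγ.ne_zero_of_mem_range hz
  have hcont : ContinuousOn (fun z => Real.exp (‖b i * z‖ * (1 - ‖q‖)⁻¹) *
      Real.exp (‖b i / z‖ * (1 - ‖q‖)⁻¹) * ‖awIntegrand q b F z‖) (range γ) := by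
    have := continuousOn_awIntegrand hq hγ hF
    fun_prop
  obtain ⟨C, hC⟩ := (isCompact_range γ.continuous).exists_bound_of_continuousOn hcont
  refine ⟨C, fun n z hz => le_trans ?_ ((Real.le_norm_self _).trans (hC z hz))⟩
  rw [awIntegrand_update_pow_mul hq F i (hγ.qPochPair_ne_zero hq hz i), norm_mul, norm_mul]
  gcongr <;> exact norm_prod_one_sub_mul_pow_le hq _ n

theorem tendsto_lineIntegral_awIntegrand_update (hq : ‖q‖ < 1)
    (hγ : IsSeparatingContour γ (innerPoles q b) (outerPoles q b)) {F : ℂ → ℂ}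
    (hF : ∀ z ≠ 0, DifferentiableAt ℂ F z) (i : Fin 4) :
    Tendsto (fun n => lineIntegral (awIntegrand q (update b i (q ^ n * b i)) F) γ) atTop
      (𝓝 (lineIntegral (awIntegrand q (update b i 0) F) γ)) := by
  obtain ⟨C, hC⟩ := exists_norm_awIntegrand_update_le hq hγ hF i
  exact tendsto_lineIntegral hγ.piecewiseC1
    (fun n => continuousOn_awIntegrand hq (hγ.update i (.inr ⟨n, rfl⟩)) hF) hC fun z hz =>
      tendsto_awIntegrand_update hq F i ((hγ.update i (.inl rfl)).qPochPair_ne_zero hq hz)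

theorem lineIntegral_awIntegrand_update_zero (hq : ‖q‖ < 1) (hq0 : q ≠ 0)
    (hγ : IsSeparatingContour γ (innerPoles q b) (outerPoles q b)) (i : Fin 4) :
    lineIntegral (awIntegrand q b (poisedTheta q)) γ *
        ∏ k, qPochInf (b i * b (i.succAbove k)) q =
      qPochInf (∏ j, b j) q * lineIntegral (awIntegrand q (update b i 0) (poisedTheta q)) γ := by
  have hstep (n : ℕ) : (∏ k, (1 - b i * b (i.succAbove k) * q ^ n)) *
        lineIntegral (awIntegrand q (update b i (q ^ n * b i)) (poisedTheta q)) γ =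
      (1 - (∏ j, b j) * q ^ n) *
        lineIntegral (awIntegrand q (update b i (q ^ (n + 1) * b i)) (poisedTheta q)) γ := by
    have h := lineIntegral_awIntegrand_contiguous hq hq0 (hγ.update i (.inr ⟨n, rfl⟩)) i
    simp only [prod_update_mul, update_self, update_idem, ne_eq, Fin.succAbove_ne,
      not_false_eq_true, update_of_ne] at h
    convert h.symm using 3 <;> ring_nf
  simpa [mul_comm] using mul_eq_mul_of_tendsto_of_recurrence
    (tendsto_prod_prod_qPochInf hq fun k => b i * b (i.succAbove k))
    (tendsto_prod_qPochInf hq (∏ j, b j)) (tendsto_lineIntegral_awIntegrand_update hq hγ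
      (fun _ => differentiableAt_poisedTheta hq hq0) i) hstep

theorem lineIntegral_awIntegrand_eq (hq : ‖q‖ < 1) (hq0 : q ≠ 0)
    (hγ : IsSeparatingContour γ (innerPoles q b) (outerPoles q b)) :
    lineIntegral (awIntegrand q b (poisedTheta q)) γ *
        ∏ j, ∏ k ∈ Finset.Ioi j, qPochInf (b j * b k) q =
      qPochInf (∏ j, b j) q * (2 * (2 * Real.pi * Complex.I)) := by
  have hzero (i : Fin 4) {b : Fin 4 → ℂ} (h : b i = 0) : ∏ j, b j = 0 :=
    Finset.prod_eq_zero (Finset.mem_univ i) h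
  have hγ₀ := hγ.update 0 (.inl rfl)
  have hγ₁ := hγ₀.update 1 (.inl rfl)
  have hγ₂ := hγ₁.update 2 (.inl rfl)
  have hγ₃ := hγ₂.update 3 (.inl rfl)
  have h₀ := lineIntegral_awIntegrand_update_zero hq hq0 hγ 0
  have h₁ := lineIntegral_awIntegrand_update_zero hq hq0 hγ₀ 1
  have h₂ := lineIntegral_awIntegrand_update_zero hq hq0 hγ₁ 2
  have h₃ := lineIntegral_awIntegrand_update_zero hq hq0 hγ₂ 3
  have hall : update (update (update (update b 0 0) 1 0) 2 0) 3 0 = 0 := by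
    ext j
    fin_cases j <;> rfl
  rw [hall] at hγ₃ h₃
  rw [lineIntegral_awIntegrand_zero hq hq0 hγ₃] at h₃
  rw [hzero 0 rfl, qPochInf_zero, one_mul] at h₁ h₂ h₃
  rw [← h₃, ← h₂, ← h₁, ← mul_assoc, ← mul_assoc, ← mul_assoc, ← h₀]
  simp [Fin.prod_univ_succ, update, Fin.succAbove, mul_assoc]

end AskeyWilsonEvaluation

section Assembly

open Set

variable {q s z : ℂ} {a b : Fin 4 → ℂ} {p p₀ : ℂ} {γ : Path p p} {γ₀ : Path p₀ p₀}

theorem mul_mem_polesToZero (hs : s ≠ 0) (b : Fin 4 → ℂ) (m : ℤ) (z : ℂ) :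
    s ^ (-m) * z ∈ polesToZero q s b m ↔ z ∈ innerPoles q b := by
  have h : s ^ (-m) ≠ 0 := zpow_ne_zero _ hs
  simp only [polesToZero, innerPoles, mem_ofPred_eq, mul_eq_zero, h, false_or, mul_assoc,
    mul_right_inj' h]

theorem mul_mem_polesToInfinity (hs : s ≠ 0) (b : Fin 4 → ℂ) (m : ℤ) (z : ℂ) :
    s ^ (-m) * z ∈ polesToInfinity q s b m ↔ z ∈ outerPoles q b := by
  have h (j : Fin 4) : s ^ m * b j * (s ^ (-m) * z) = b j * z := by
    have := zpow_ne_zero m hs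
    rw [zpow_neg]
    field_simp
  simp only [polesToInfinity, outerPoles, mem_ofPred_eq, h]

theorem zpow_eq_sq_of_sq_eq (hs : s ^ 2 = q) (m : ℤ) : q ^ m = (s ^ m) ^ 2 := by
  rw [← hs, ← zpow_natCast, ← zpow_natCast, zpow_comm]

theorem qPochInf_numerator_eq (hs0 : s ≠ 0) (hs : s ^ 2 = q) (m : ℤ) (a : ℂ) (hz : z ≠ 0) :
    qPochInf (q * s ^ m / (a * z)) q * qPochInf (q * s ^ (-m) * z / a) q =
      qPochPair q (q * a⁻¹) (q * a⁻¹) (q ^ m * (s ^ m * z)⁻¹) := by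
  have hsm : s ^ m ≠ 0 := zpow_ne_zero m hs0
  rw [qPochPair, zpow_eq_sq_of_sq_eq hs m, zpow_neg]
  congr 2 <;> field_simp

theorem qPochInf_denominator_eq (s : ℂ) (m : ℤ) (b z : ℂ) :
    qPochInf (s ^ m * b * z) q * qPochInf (s ^ (-m) * b / z) q = qPochPair q b b (s ^ m * z) := by
  rw [qPochPair, zpow_neg]
  congr 2
  · ring
  · field_simp

theorem zpow_mul_inv_zpow_eq (hq0 : q ≠ 0) (hs : s ^ 2 = q) (m : ℤ) (z : ℂ) :
    q ^ (2 * m ^ 2 - m) * (s ^ m * z)⁻¹ ^ (4 * m) = (q ^ m * z ^ (4 * m))⁻¹ := by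
  have h : (s ^ m) ^ (4 * m) = q ^ (2 * m ^ 2) := by
    rw [← hs, ← zpow_natCast, ← zpow_mul, ← zpow_mul]
    congr 1
    push_cast
    ring
  have := zpow_ne_zero (2 * m ^ 2) hq0
  rw [inv_zpow, mul_zpow, h, zpow_sub₀ hq0]
  field_simp

theorem wpIntegrand_eq (hq0 : q ≠ 0) (hs0 : s ≠ 0) (hs : s ^ 2 = q) (a b : Fin 4 → ℂ) (m : ℤ)
    (hz : z ≠ 0) :
    wpIntegrand q s a b m z = (1 - (s ^ m * z) ^ 2) * poisedTerm q a⁻¹ m (s ^ m * z)⁻¹ /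
      ∏ j, qPochPair q (b j) (b j) (s ^ m * z) := by
  have hsm : s ^ m ≠ 0 := zpow_ne_zero m hs0
  have hsq : q ^ m * z ^ 2 = (s ^ m * z) ^ 2 := by
    rw [zpow_eq_sq_of_sq_eq hs, mul_pow]
  have hinv : q ^ m * z ^ (-2 : ℤ) = (q ^ m * (s ^ m * z)⁻¹) ^ 2 := by
    rw [zpow_eq_sq_of_sq_eq hs, zpow_neg, zpow_ofNat]
    field_simp
  simp only [wpIntegrand, poisedTerm, poisedCore, Pi.inv_apply, zpow_mul_inv_zpow_eq hq0 hs, hsq,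
    hinv, qPochInf_numerator_eq hs0 hs m _ hz, qPochInf_denominator_eq, Finset.prod_div_distrib]
  ring

theorem wpIntegrand_div_eq (hq0 : q ≠ 0) (hs0 : s ≠ 0) (hs : s ^ 2 = q) (a b : Fin 4 → ℂ) (m : ℤ)
    (hz : z ≠ 0) :
    wpIntegrand q s a b m z / (2 * Real.pi * Complex.I * z) = (2 * Real.pi * Complex.I)⁻¹ *
      (s ^ m * awIntegrand q b (fun z => poisedTerm q a⁻¹ m z⁻¹) (s ^ m * z)) := by
  have hsm : s ^ m ≠ 0 := zpow_ne_zero m hs0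
  rw [wpIntegrand_eq hq0 hs0 hs a b m hz, awIntegrand]
  field_simp

theorem contourIntegral_wpIntegrand_eq (hq : ‖q‖ < 1) (hq0 : q ≠ 0) (hs0 : s ≠ 0) (hs : s ^ 2 = q)
    (a : Fin 4 → ℂ) (m : ℤ)
    (hγ : IsSeparatingContour γ (polesToZero q s b m) (polesToInfinity q s b m))
    (hγ₀ : IsSeparatingContour γ₀ (innerPoles q b) (outerPoles q b)) :
    contourIntegral (fun z => wpIntegrand q s a b m z / (2 * (Real.pi : ℂ) * Complex.I * z)) γ =
      (2 * Real.pi * Complex.I)⁻¹ *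
        lineIntegral (awIntegrand q b fun z => poisedTerm q a⁻¹ m z⁻¹) γ₀ := by
  have hsm : s ^ m ≠ 0 := zpow_ne_zero m hs0
  have hinv (z : ℂ) : s ^ (-m) * (s ^ m * z) = z := by rw [zpow_neg, inv_mul_cancel_left₀ hsm]
  have hscale : IsSeparatingContour (scalePath (s ^ m) γ) (innerPoles q b) (outerPoles q b) :=
    hγ.scale hsm (fun z => by rw [← mul_mem_polesToZero hs0 b m, hinv])
      fun z => by rw [← mul_mem_polesToInfinity hs0 b m, hinv]
  have hne (z : ℂ) (hz : z ∈ range γ) : z ≠ 0 := by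
    rintro rfl
    obtain ⟨t, ht⟩ := hz
    exact hγ.avoids_inside t (.inl ht)
  calc contourIntegral (fun z => wpIntegrand q s a b m z / (2 * (Real.pi : ℂ) * Complex.I * z)) γ
      = (2 * Real.pi * Complex.I)⁻¹ *
          lineIntegral (awIntegrand q b fun z => poisedTerm q a⁻¹ m z⁻¹) (scalePath (s ^ m) γ) := by
        rw [contourIntegral_eq_lineIntegral, lineIntegral_scalePath, ← lineIntegral_const_mul]
        exact lineIntegral_congr fun z hz => wpIntegrand_div_eq hq0 hs0 hs a b m (hne z hz)
    _ = _ := by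
        congr 1
        exact lineIntegral_eq_of_isSeparatingContour hq hscale hγ₀ fun _ =>
          differentiableAt_awNumerator fun _ => differentiableAt_poisedTerm_inv hq hq0 a⁻¹ m

theorem lineIntegral_awIntegrand_tsum_poisedTerm (hq : ‖q‖ < 1) (hq0 : q ≠ 0) {c : Fin 4 → ℂ}
    (hc : ‖q * ∏ j, c j‖ < 1)
    (hγ : IsSeparatingContour γ (innerPoles q b) (outerPoles q b)) :
    lineIntegral (awIntegrand q b fun z => ∑' m, poisedTerm q c m z⁻¹) γ =
      (∏ j, ∏ k ∈ Finset.Ioi j, qPochInf (q * (c j * c k)) q) / qPochInf (q * ∏ j, c j) q *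
        lineIntegral (awIntegrand q b (poisedTheta q)) γ := by
  rw [← lineIntegral_const_mul]
  refine lineIntegral_congr fun z hz => ?_
  have hsum := tsum_poisedTerm_eq hq hq0 (inv_ne_zero (hγ.ne_zero_of_mem_range hz)) hc
  rw [awIntegrand, awIntegrand, poisedTheta,
    eq_div_of_mul_eq (qPochInf_ne_zero_of_norm_lt_one hq hc) ((mul_comm _ _).trans hsum)]
  ring

theorem hasSum_lineIntegral_awIntegrand_eq (hq : ‖q‖ < 1) (hq0 : q ≠ 0)
    (hconv : ‖q‖ < ‖∏ j, a j‖) (hb : ∀ (j k : Fin 4) (n : ℕ), b j * b k * q ^ n ≠ 1)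
    (hγ : IsSeparatingContour γ (innerPoles q b) (outerPoles q b)) :
    HasSum (fun m => (2 * Real.pi * Complex.I)⁻¹ *
        lineIntegral (awIntegrand q b fun z => poisedTerm q a⁻¹ m z⁻¹) γ)
      (2 * qPochInf (∏ j, b j) q / qPochInf (q / ∏ j, a j) q *
        ∏ j : Fin 4, ∏ k ∈ Finset.Ioi j,
          qPochInf (q / (a j * a k)) q / qPochInf (b j * b k) q) := by
  have hprod : q * ∏ j, a⁻¹ j = q / ∏ j, a j := by
    simp only [Pi.inv_apply, Finset.prod_inv_distrib, div_eq_mul_inv]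
  have hc : ‖q * ∏ j, a⁻¹ j‖ < 1 := by
    rw [hprod, norm_div]
    exact (div_lt_one ((norm_nonneg q).trans_lt hconv)).2 hconv
  have hB : ∏ j, ∏ k ∈ Finset.Ioi j, qPochInf (b j * b k) q ≠ 0 :=
    Finset.prod_ne_zero_iff.2 fun j _ => Finset.prod_ne_zero_iff.2 fun k _ =>
      qPochInf_ne_zero hq (hb j k)
  have hvalue : 2 * qPochInf (∏ j, b j) q / qPochInf (q / ∏ j, a j) q * ∏ j : Fin 4,
        ∏ k ∈ Finset.Ioi j, qPochInf (q / (a j * a k)) q / qPochInf (b j * b k) q =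
      (2 * Real.pi * Complex.I)⁻¹ *
        lineIntegral (awIntegrand q b fun z => ∑' m, poisedTerm q a⁻¹ m z⁻¹) γ := by
    rw [lineIntegral_awIntegrand_tsum_poisedTerm hq hq0 hc hγ, hprod,
      eq_div_of_mul_eq hB (lineIntegral_awIntegrand_eq hq hq0 hγ)]
    simp only [Finset.prod_div_distrib, Pi.inv_apply, ← div_eq_mul_inv]
    field_simp
  rw [hvalue]
  exact (hasSum_lineIntegral_awIntegrand hq hq0 hγ hc).mul_left _

end Assembly

theorem proposition2 (q s : ℂ) (hq0 : q ≠ 0) (hq1 : ‖q‖ < 1) (hs : s ^ 2 = q)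
    (a b : Fin 4 → ℂ) (ha : ∀ j, a j ≠ 0) (hconv : ‖q‖ < ‖∏ j, a j‖)
    (hb : ∀ (j k : Fin 4) (n : ℕ), b j * b k * q ^ n ≠ 1) :
    (∀ m : ℤ, ∃ (p : ℂ) (γ : Path p p),
      IsSeparatingContour γ (polesToZero q s b m) (polesToInfinity q s b m)) ∧
    ∀ (p : ℤ → ℂ) (γ : ∀ m : ℤ, Path (p m) (p m)),
      (∀ m : ℤ,
        IsSeparatingContour (γ m) (polesToZero q s b m) (polesToInfinity q s b m)) →
      HasSum
        (fun m : ℤ =>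
          contourIntegral
            (fun z => wpIntegrand q s a b m z / (2 * (Real.pi : ℂ) * Complex.I * z)) (γ m))
        (2 * qPochInf (∏ j, b j) q / qPochInf (q / ∏ j, a j) q *
          ∏ j : Fin 4, ∏ k ∈ Finset.Ioi j,
            qPochInf (q / (a j * a k)) q / qPochInf (b j * b k) q) := by
  have hs0 : s ≠ 0 := by
    rintro rfl
    exact hq0 (by rw [← hs, zero_pow two_ne_zero])
  obtain ⟨p₀, γ₀, hγ₀⟩ := exists_isSeparatingContour_innerPoles_outerPoles hq1 hb
  refine ⟨fun m => ⟨_, _, hγ₀.scale (zpow_ne_zero (-m) hs0) (mul_mem_polesToZero hs0 b m)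
    (mul_mem_polesToInfinity hs0 b m)⟩, fun p γ hγ => ?_⟩
  simp only [contourIntegral_wpIntegrand_eq hq1 hq0 hs0 hs a _ (hγ _) hγ₀]
  exact hasSum_lineIntegral_awIntegrand_eq hq1 hq0 hconv hb hγ₀
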